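/- Let $k$ be a field. A differential graded (DG) $k$-vector space is $V=\bigoplus_{n\in\mathbb Z}V_n$ with a differential $d:V_n\to V_{n+1}$, $d^2=0$; tensor products over $k$ carry $d(x\otimes y)=dx\otimes y+(-1)^{|x|}x\otimes dy$. Let $(C,\Delta,\epsilon)$ be a DG coalgebra over $k$, that is, a (coassociative, counital) coalgebra in the monoidal category of DG vector spaces, and let $\mathrm{Chain}(C)$ be the category of DG left $C$-comodules $(M,\rho_M)$, with morphisms the $C$-colinear maps of degree $0$ commuting with the differentials. Let $H(C)$ be the category with the same objects and with morphisms the homotopy classes of morphisms, where $f\sim g$ if $f-g=hd+dh$ for some graded $C$-colinear map $h$ of degree $-1$ (colinearity with the Koszul sign: $\rho(h(m))=\sum(-1)^{|c|}c\otimes h(m')$ if $\rho(m)=\sum c\otimes m'$). Let $D(C)$ be the localization of $H(C)$ at the quasi-isomorphisms. An object $X$ is *closed* if, for every $N\in\mathrm{Chain}(C)$, the localization functor induces a bijection $\mathrm{Hom}_{H(C)}(N,X)\to\mathrm{Hom}_{D(C)}(N,X)$. Let $\mathrm{Chain}^+(C)$, $H^+(C)$, $D^+(C)$ be the full subcategories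 of the objects isomorphic (in the respective category) to a left bounded comodule, i.e. one with $M_n=0$ for all sufficiently small $n$. For $M\in\mathrm{Chain}(C)$ the standard (cobar) resolution is $C(M)=\bigoplus_{r\ge1}C^{\otimes r}\otimes M$, where $(c_1,\dots,c_r,m)$ has degree $|c_1|+\dots+|c_r|+|m|+r-1$, with the differential $$\partial(c_1,\dots,c_r,m)=(-1)^{r-1}d(c_1,\dots,c_r,m)+\sum_{i=1}^{r+1}(-1)^{i+1}(c_1,\dots,\Delta(c_i),\dots,c_r,m)$$ (where $d$ is the differential of the tensor product $C^{\otimes r}\otimes M$, $c_{r+1}=m$ and $\Delta(m)=\rho_M(m)$) and the coaction $(c_1,\dots,c_r,m)\mapsto\sum(-1)^{(r-1)|c_1'|}\,c_1'\otimes(c_1'',c_2,\dots,c_r,m)$, where $\Delta(c_1)=\sum c_1'\otimes c_1''$. This is a functor $\mathrm{Chain}(C)\to\mathrm{Chain}(C)$, and $\rho_M:M\to C\otimes M\subseteq C(M)$ is a morphism natural in $M$. **Theorem.** Let $C$ be positively graded, i.e. $C_n=0$ for $n<0$. For every left bounded $M\in\mathrm{Chain}(C)$, the object $C(M)$ is closed,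 $C(M)$ is left bounded, and the natural morphism $\rho_M:M\to C(M)$ is a quasi-isomorphism. Consequently the localization functor induces an equivalence from the full subcategory of closed objects of $H^+(C)$ to $D^+(C)$. -/

import Mathlib

universe u v

noncomputable section

open CategoryTheory TensorProduct DirectSum

namespace DGCo

/-- A differential `ℤ`-graded `k`-vector space `V = ⨁ n, V_n` with `d : V_n → V_{n+1}`, `d² = 0`. -/
structure DGModule (k : Type u) [Field k] where
  carrier : Type v
  [addCommGroup : AddCommGroup carrier]
  [module : Module k carrier]
  /-- the homogeneous components -/
  deg : ℤ → Submodule k carrier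
  isInternal : DirectSum.IsInternal deg
  /-- the differential -/
  d : carrier →ₗ[k] carrier
  d_mem : ∀ {n : ℤ} {x : carrier}, x ∈ deg n → d x ∈ deg (n + 1)
  d_comp_d : d ∘ₗ d = 0

attribute [instance] DGModule.addCommGroup DGModule.module

instance (k : Type u) [Field k] : CoeSort (DGModule.{u, v} k) (Type v) := ⟨DGModule.carrier⟩

variable {k : Type u} [Field k]

/-- A criterion for a family of submodules to be a grading. -/
theorem isInternal_of_split {V : Type v} [AddCommGroup V] [Module k V] (A : ℤ → Submodule k V)
    (hA : iSup A = ⊤) (Φ : V →ₗ[k] (ℤ →₀ V))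
    (hΦ : ∀ (n : ℤ) (x : V), x ∈ A n → Φ x = Finsupp.single n x) : DirectSum.IsInternal A := by
  classical
  constructor
  · have key : ∀ (y : ⨁ i, A i) (i : ℤ),
        Φ (DirectSum.coeAddMonoidHom A y) i = (y i : V) := by
      intro y i
      induction y using DirectSum.induction_on with
      | zero => simp
      | of j x =>
        rw [DirectSum.coeAddMonoidHom_of, hΦ j _ x.2, DirectSum.coe_of_apply, Finsupp.single_apply]
        split_ifs <;> simp
      | add x y hx hy => simp [hx, hy]
    intro x y hxy
    refine DFinsupp.ext fun i => Subtype.ext ?_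
    have h := key x i
    rw [hxy, key y i] at h
    exact h.symm
  · intro x
    have h : x ∈ iSup A := hA ▸ Submodule.mem_top
    obtain ⟨f, hf⟩ := (Submodule.mem_iSup_iff_exists_dfinsupp' A x).1 h
    refine ⟨f, ?_⟩
    rw [← hf]
    exact DFinsupp.sumAddHom_apply _ _

namespace DGModule

/-- `v ↦ ∑ n, v_n · e_n`, the family of homogeneous components of a vector. -/
def comps (V : DGModule.{u, v} k) : V →ₗ[k] (ℤ →₀ V) :=
  DirectSum.toModule k ℤ (ℤ →₀ V) (fun n => Finsupp.lsingle n ∘ₗ (V.deg n).subtype) ∘ₗ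
    (LinearEquiv.ofBijective (DirectSum.coeLinearMap V.deg) V.isInternal).symm.toLinearMap

theorem comps_of_mem (V : DGModule.{u, v} k) {n : ℤ} {x : V} (hx : x ∈ V.deg n) :
    V.comps x = Finsupp.single n x := by
  have h : (LinearEquiv.ofBijective (DirectSum.coeLinearMap V.deg) V.isInternal).symm x =
      DirectSum.lof k ℤ (fun n => V.deg n) n ⟨x, hx⟩ := by
    rw [LinearEquiv.symm_apply_eq]
    exact (DirectSum.coeLinearMap_lof V.deg n ⟨x, hx⟩).symm
  rw [comps, LinearMap.comp_apply, LinearEquiv.coe_coe, h, DirectSum.toModule_lof]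
  rfl

/-- The parity involution: `σ v = (-1)^n v` for `v` homogeneous of degree `n`. -/
def parity (V : DGModule.{u, v} k) : Module.End k V :=
  Finsupp.lsum k (fun n : ℤ => ((n.negOnePow : ℤ) : k) • LinearMap.id) ∘ₗ V.comps

theorem parity_of_mem (V : DGModule.{u, v} k) {n : ℤ} {x : V} (hx : x ∈ V.deg n) :
    V.parity x = ((n.negOnePow : ℤ) : k) • x := by
  simp [parity, V.comps_of_mem hx]

/-- Linear maps that agree on homogeneous elements are equal. -/
theorem hom_ext (V : DGModule.{u, v} k) {X : Type v} [AddCommGroup X] [Module k X]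
    {f g : V →ₗ[k] X} (h : ∀ n, ∀ x ∈ V.deg n, f x = g x) : f = g := by
  have h1 : (⊤ : Submodule k V) ≤ LinearMap.eqLocus f g := by
    rw [← V.isInternal.submodule_iSup_eq_top]
    exact iSup_le h
  exact LinearMap.ext fun x => h1 Submodule.mem_top

theorem parity_mem (V : DGModule.{u, v} k) {n : ℤ} {x : V} (hx : x ∈ V.deg n) :
    V.parity x ∈ V.deg n := by
  rw [V.parity_of_mem hx]; exact Submodule.smul_mem _ _ hx

theorem sign_mul_self (n : ℤ) : ((n.negOnePow : ℤ) : k) * ((n.negOnePow : ℤ) : k) = 1 := by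
  rw [← Int.cast_mul, ← Units.val_mul, Int.units_mul_self]; simp

theorem parity_comp_parity (V : DGModule.{u, v} k) : V.parity ∘ₗ V.parity = LinearMap.id := by
  refine V.hom_ext fun n x hx => ?_
  rw [LinearMap.comp_apply, V.parity_of_mem hx, map_smul, V.parity_of_mem hx, smul_smul,
    sign_mul_self, one_smul, LinearMap.id_apply]

theorem parity_comp_d (V : DGModule.{u, v} k) : V.parity ∘ₗ V.d = -(V.d ∘ₗ V.parity) := by
  refine V.hom_ext fun n x hx => ?_
  simp [V.parity_of_mem hx, V.parity_of_mem (V.d_mem hx), Int.negOnePow_succ]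

/-- `(V ⊗ W)_n = ⨁_{p + q = n} V_p ⊗ W_q`. -/
def tensorDeg (V W : DGModule.{u, v} k) (n : ℤ) : Submodule k (V ⊗[k] W) :=
  ⨆ p : ℤ, Submodule.map₂ (TensorProduct.mk k V W) (V.deg p) (W.deg (n - p))

/-- `d (x ⊗ y) = d x ⊗ y + (-1)^|x| x ⊗ d y`. -/
def tensorD (V W : DGModule.{u, v} k) : V ⊗[k] W →ₗ[k] V ⊗[k] W :=
  TensorProduct.map V.d LinearMap.id + TensorProduct.map V.parity W.d

theorem tmul_mem (V W : DGModule.{u, v} k) {p q n : ℤ} (h : p + q = n) {x : V} {y : W}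
    (hx : x ∈ V.deg p) (hy : y ∈ W.deg q) : x ⊗ₜ[k] y ∈ tensorDeg V W n := by
  obtain rfl : q = n - p := by omega
  exact Submodule.mem_iSup_of_mem p (Submodule.apply_mem_map₂ _ hx hy)

/-- To map `(V ⊗ W)_n` into a subspace it is enough to map homogeneous pure tensors there. -/
theorem tensorDeg_le (V W : DGModule.{u, v} k) {n : ℤ} {S : Submodule k (V ⊗[k] W)}
    (h : ∀ p q : ℤ, p + q = n → ∀ x ∈ V.deg p, ∀ y ∈ W.deg q, x ⊗ₜ[k] y ∈ S) :
    tensorDeg V W n ≤ S :=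
  iSup_le fun p => Submodule.map₂_le.2 fun x hx y hy => h p (n - p) (by omega) x hx y hy

theorem iSup_tensorDeg (V W : DGModule.{u, v} k) : iSup (tensorDeg V W) = ⊤ := by
  rw [eq_top_iff, ← TensorProduct.map₂_mk_top_top_eq_top,
    ← V.isInternal.submodule_iSup_eq_top, ← W.isInternal.submodule_iSup_eq_top,
    Submodule.map₂_iSup_left]
  refine iSup_le fun p => ?_
  rw [Submodule.map₂_iSup_right]
  refine iSup_le fun q => Submodule.map₂_le.2 fun x hx y hy => ?_
  exact Submodule.mem_iSup_of_mem (p + q) (tmul_mem V W rfl hx hy)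

theorem isInternal_tensorDeg (V W : DGModule.{u, v} k) :
    DirectSum.IsInternal (tensorDeg V W) := by
  classical
  let Φ : V ⊗[k] W →ₗ[k] (ℤ →₀ (V ⊗[k] W)) :=
    Finsupp.lmapDomain (V ⊗[k] W) k (fun pq : ℤ × ℤ => pq.1 + pq.2) ∘ₗ
      (finsuppTensorFinsupp k k V W ℤ ℤ).toLinearMap ∘ₗ TensorProduct.map V.comps W.comps
  refine isInternal_of_split _ (iSup_tensorDeg V W) Φ fun n x hx => ?_
  have : tensorDeg V W n ≤ LinearMap.eqLocus Φ (Finsupp.lsingle n) := by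
    refine tensorDeg_le V W fun p q h x hx y hy => ?_
    simp [Φ, V.comps_of_mem hx, W.comps_of_mem hy, Finsupp.mapDomain_single, h]
  exact this hx

/-- The tensor product of differential graded vector spaces. -/
abbrev tensor (V W : DGModule.{u, v} k) : DGModule.{u, v} k where
  carrier := V ⊗[k] W
  deg := tensorDeg V W
  isInternal := isInternal_tensorDeg V W
  d := tensorD V W
  d_mem := by
    intro n x hx
    have : tensorDeg V W n ≤ (tensorDeg V W (n + 1)).comap (tensorD V W) := by
      refine tensorDeg_le V W fun p q h x hx y hy => ?_
      simp only [Submodule.mem_comap, tensorD, LinearMap.add_apply, TensorProduct.map_tmul,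
        LinearMap.id_apply]
      exact Submodule.add_mem _ (tmul_mem V W (by omega) (V.d_mem hx) hy)
        (tmul_mem V W (by omega) (V.parity_mem hx) (W.d_mem hy))
    exact this hx
  d_comp_d := by
    have h1 := V.parity_comp_d
    ext x y
    have hd : V.d (V.d x) = 0 := LinearMap.congr_fun V.d_comp_d x
    have hd' : W.d (W.d y) = 0 := LinearMap.congr_fun W.d_comp_d y
    have hp : V.parity (V.d x) = -V.d (V.parity x) := LinearMap.congr_fun h1 x
    simp [tensorD, hd, hd', hp, TensorProduct.neg_tmul]

end DGModule

/-- A differential graded `k`-coalgebra: a coalgebra whose comultiplication and counit are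
morphisms of differential graded vector spaces (`k` sits in degree `0` with `d = 0`). -/
structure DGCoalgebra (k : Type u) [Field k] extends DGModule.{u, v} k where
  [coalgebra : Coalgebra k carrier]
  comul_mem : ∀ {n : ℤ} {x : carrier}, x ∈ deg n →
    Coalgebra.comul (R := k) x ∈ toDGModule.tensorDeg toDGModule n
  comul_comp_d : Coalgebra.comul (R := k) ∘ₗ d =
    toDGModule.tensorD toDGModule ∘ₗ Coalgebra.comul (R := k)
  counit_of_mem : ∀ {n : ℤ} {x : carrier}, x ∈ deg n → n ≠ 0 → Coalgebra.counit (R := k) x = 0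
  counit_comp_d : Coalgebra.counit (R := k) ∘ₗ d = 0

attribute [instance] DGCoalgebra.coalgebra

/-- `C` is positively graded: `C_n = 0` for `n < 0`. -/
def DGCoalgebra.PositivelyGraded (C : DGCoalgebra.{u, v} k) : Prop := ∀ n < 0, C.deg n = ⊥

/-- `Δ ⊗ id : C ⊗ W → C ⊗ (C ⊗ W)`. -/
def DGCoalgebra.comulTensor (C : DGCoalgebra.{u, v} k) (W : Type v) [AddCommGroup W] [Module k W] :
    C.carrier ⊗[k] W →ₗ[k] C.carrier ⊗[k] (C.carrier ⊗[k] W) :=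
  (TensorProduct.assoc k C.carrier C.carrier W).toLinearMap ∘ₗ
    TensorProduct.map Coalgebra.comul LinearMap.id

/-- A differential graded vector space `M` with a coassociative map `M → C ⊗ M` of differential
graded vector spaces (no counit condition). -/
structure DGPrecomodule (C : DGCoalgebra.{u, v} k) extends DGModule.{u, v} k where
  coact : carrier →ₗ[k] C.carrier ⊗[k] carrier
  coact_mem : ∀ {n : ℤ} {x : carrier}, x ∈ deg n → coact x ∈ C.toDGModule.tensorDeg toDGModule n
  coact_comp_d : coact ∘ₗ d = C.toDGModule.tensorD toDGModule ∘ₗ coact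
  coassoc : C.comulTensor carrier ∘ₗ coact = TensorProduct.map LinearMap.id coact ∘ₗ coact

/-- A differential graded left `C`-comodule; these are the objects of `Chain(C)`. -/
structure DGComodule (C : DGCoalgebra.{u, v} k) extends DGPrecomodule.{u, v} C where
  counit_coact : (TensorProduct.lid k carrier).toLinearMap ∘ₗ
    TensorProduct.map Coalgebra.counit LinearMap.id ∘ₗ coact = LinearMap.id

variable {C : DGCoalgebra.{u, v} k}

/-- A morphism: a `k`-linear `C`-colinear map of degree `0` that commutes with the differentials. -/
@[ext]
structure DGPrecomodule.Hom (M N : DGPrecomodule.{u, v} C) where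
  lin : M.carrier →ₗ[k] N.carrier
  map_mem : ∀ {n : ℤ} {x : M.carrier}, x ∈ M.deg n → lin x ∈ N.deg n
  comp_d : lin ∘ₗ M.d = N.d ∘ₗ lin
  colinear : N.coact ∘ₗ lin = TensorProduct.map LinearMap.id lin ∘ₗ M.coact

/-- The category `Chain(C)`. -/
instance : Category.{v} (DGComodule.{u, v} C) where
  Hom M N := DGPrecomodule.Hom M.toDGPrecomodule N.toDGPrecomodule
  id M :=
    { lin := LinearMap.id
      map_mem := fun h => h
      comp_d := rfl
      colinear := by simp }
  comp {M N P} f g :=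
    { lin := g.lin ∘ₗ f.lin
      map_mem := fun h => g.map_mem (f.map_mem h)
      comp_d := by rw [LinearMap.comp_assoc, f.comp_d, ← LinearMap.comp_assoc, g.comp_d,
        LinearMap.comp_assoc]
      colinear := by
        rw [← LinearMap.comp_assoc, g.colinear, LinearMap.comp_assoc, f.colinear,
          ← LinearMap.comp_assoc, ← TensorProduct.map_comp, LinearMap.id_comp] }

/-- `M` is left bounded: `M_n = 0` for all sufficiently small `n`. -/
def DGComodule.LeftBounded (M : DGComodule.{u, v} C) : Prop := ∃ n₀ : ℤ, ∀ n < n₀, M.deg n = ⊥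

/-- The homology `ker d / im d`. -/
abbrev DGModule.Homology (V : DGModule.{u, v} k) : Type v :=
  LinearMap.ker V.d ⧸ (LinearMap.range V.d).comap (LinearMap.ker V.d).subtype

/-- The restriction of a morphism to cycles. -/
def cyclesMap {M N : DGComodule.{u, v} C} (f : M ⟶ N) :
    LinearMap.ker M.d →ₗ[k] LinearMap.ker N.d :=
  f.lin.restrict fun x hx => by
    have h := LinearMap.congr_fun f.comp_d x
    simp only [LinearMap.comp_apply, LinearMap.mem_ker.1 hx, map_zero] at h
    exact LinearMap.mem_ker.2 h.symm

/-- The map induced in homology. -/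
def homologyMap {M N : DGComodule.{u, v} C} (f : M ⟶ N) : M.Homology →ₗ[k] N.Homology :=
  Submodule.mapQ _ _ (cyclesMap f) (by
    rintro ⟨x, hx⟩ ⟨y, hy⟩
    exact ⟨f.lin y, by rw [← LinearMap.comp_apply, ← f.comp_d, LinearMap.comp_apply, hy]; rfl⟩)

/-- `f` is a quasi-isomorphism. -/
def QuasiIso {M N : DGComodule.{u, v} C} (f : M ⟶ N) : Prop := Function.Bijective (homologyMap f)

/-- `f` and `g` are homotopic: `f - g = h d + d h` for a graded `C`-colinear map `h` of degree `-1`.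
As `h` has degree `-1`, its colinearity reads
`ρ (h m) = ∑ (-1)^|c| c ⊗ h m'` for `ρ m = ∑ c ⊗ m'`, by the Koszul sign rule. -/
def Homotopic (C : DGCoalgebra.{u, v} k) : HomRel (DGComodule.{u, v} C) := fun M N f g =>
  ∃ h : M.carrier →ₗ[k] N.carrier,
    (∀ (n : ℤ) (x : M.carrier), x ∈ M.deg n → h x ∈ N.deg (n - 1)) ∧
    N.coact ∘ₗ h = TensorProduct.map C.parity h ∘ₗ M.coact ∧
    f.lin - g.lin = h ∘ₗ M.d + N.d ∘ₗ h

/-- Homotopy is an equivalence relation compatible with composition, so that the morphisms of the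
quotient category below are exactly the homotopy classes of morphisms. -/
instance (C : DGCoalgebra.{u, v} k) : Congruence (Homotopic C) where
  comp_left {X Y Z} f {g g'} := by
    rintro ⟨h, hdeg, hco, hh⟩
    refine ⟨h ∘ₗ f.lin, fun n x hx => hdeg n _ (f.map_mem hx), ?_, ?_⟩
    · rw [← LinearMap.comp_assoc, hco, LinearMap.comp_assoc, f.colinear, ← LinearMap.comp_assoc,
        ← TensorProduct.map_comp, LinearMap.comp_id]
    · change g.lin ∘ₗ f.lin - g'.lin ∘ₗ f.lin = _
      rw [← LinearMap.sub_comp, hh, LinearMap.add_comp, LinearMap.comp_assoc, ← f.comp_d,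
        LinearMap.comp_assoc, LinearMap.comp_assoc]
  comp_right {X Y Z} {f f'} g := by
    rintro ⟨h, hdeg, hco, hh⟩
    refine ⟨g.lin ∘ₗ h, fun n x hx => g.map_mem (hdeg n x hx), ?_, ?_⟩
    · rw [← LinearMap.comp_assoc, g.colinear, LinearMap.comp_assoc, hco, ← LinearMap.comp_assoc,
        ← TensorProduct.map_comp, LinearMap.id_comp]
    · change g.lin ∘ₗ f.lin - g.lin ∘ₗ f'.lin = _
      rw [← LinearMap.comp_sub, hh, LinearMap.comp_add, ← LinearMap.comp_assoc,
        ← LinearMap.comp_assoc, ← LinearMap.comp_assoc, g.comp_d]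
  equivalence {X Y} :=
    { refl := fun f => ⟨0, fun _ _ _ => by simp, by simp, by simp⟩
      symm := by
        rintro f g ⟨h, hdeg, hco, hh⟩
        refine ⟨-h, fun n x hx => Submodule.neg_mem _ (hdeg n x hx), ?_, ?_⟩
        · rw [LinearMap.comp_neg, hco, ← neg_one_smul k h, TensorProduct.map_smul_right,
            LinearMap.smul_comp]
          exact (neg_one_smul k _).symm
        · rw [← neg_sub, hh, LinearMap.neg_comp, LinearMap.comp_neg, neg_add]
      trans := by
        rintro f g l ⟨h, hdeg, hco, hh⟩ ⟨h', hdeg', hco', hh'⟩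
        refine ⟨h + h', fun n x hx => Submodule.add_mem _ (hdeg n x hx) (hdeg' n x hx), ?_, ?_⟩
        · rw [LinearMap.comp_add, hco, hco', TensorProduct.map_add_right, LinearMap.add_comp]
        · rw [← sub_add_sub_cancel f.lin g.lin l.lin, hh, hh', LinearMap.add_comp,
            LinearMap.comp_add]
          abel }

/-- The homotopy category `H(C)`. -/
abbrev HCat (C : DGCoalgebra.{u, v} k) := CategoryTheory.Quotient (Homotopic C)

/-- The projection `Chain(C) ⥤ H(C)`. -/
abbrev toH (C : DGCoalgebra.{u, v} k) : DGComodule.{u, v} C ⥤ HCat C :=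
  CategoryTheory.Quotient.functor (Homotopic C)

/-- The class of quasi-isomorphisms in `H(C)`. -/
def quasiIsos (C : DGCoalgebra.{u, v} k) : MorphismProperty (HCat C) := fun X Y φ =>
  ∃ f : X.as ⟶ Y.as, (toH C).map f = φ ∧ QuasiIso f

/-- The derived category `D(C)`. -/
abbrev DCat (C : DGCoalgebra.{u, v} k) := (quasiIsos C).Localization

/-- The localization functor `H(C) ⥤ D(C)`. -/
abbrev toD (C : DGCoalgebra.{u, v} k) : HCat C ⥤ DCat C := (quasiIsos C).Q

/-- `X` is closed: for every `M` in `Chain(C)`, the localization functor induces a bijection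
`Hom_{H(C)}(M, X) → Hom_{D(C)}(M, X)`. -/
def IsClosedObj (X : DGComodule.{u, v} C) : Prop :=
  ∀ M : DGComodule.{u, v} C, Function.Bijective
    (fun φ : (toH C).obj M ⟶ (toH C).obj X => (toD C).map φ)

/-- The objects of `H⁺(C)`: those isomorphic in `H(C)` to a left bounded comodule. -/
def hPlus (C : DGCoalgebra.{u, v} k) : ObjectProperty (HCat C) := fun X =>
  ∃ N : DGComodule.{u, v} C, N.LeftBounded ∧ Nonempty (X ≅ (toH C).obj N)

/-- The objects of `D⁺(C)`: those isomorphic in `D(C)` to a left bounded comodule. -/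
def dPlus (C : DGCoalgebra.{u, v} k) : ObjectProperty (DCat C) := fun X =>
  ∃ N : DGComodule.{u, v} C, N.LeftBounded ∧ Nonempty (X ≅ (toD C).obj ((toH C).obj N))

/-- The closed objects of `H⁺(C)`. -/
def hPlusClosed (C : DGCoalgebra.{u, v} k) : ObjectProperty (HCat C) := fun X =>
  hPlus C X ∧ IsClosedObj X.as

/-- The functor from the full subcategory of closed objects of `H⁺(C)` to `D⁺(C)` that is induced
by the localization functor. -/
def closedToDPlus (C : DGCoalgebra.{u, v} k) :
    (hPlusClosed C).FullSubcategory ⥤ (dPlus C).FullSubcategory :=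
  (dPlus C).lift ((hPlusClosed C).ι ⋙ toD C) (by
    rintro ⟨X, ⟨N, hN, ⟨e⟩⟩, -⟩
    exact ⟨N, hN, ⟨(toD C).mapIso e⟩⟩)

namespace DGModule

theorem map_mem_tensorDeg {V W V' W' : DGModule.{u, v} k} {f : V →ₗ[k] V'} {g : W →ₗ[k] W'}
    {a b : ℤ} (hf : ∀ n, ∀ x ∈ V.deg n, f x ∈ V'.deg (n + a))
    (hg : ∀ n, ∀ x ∈ W.deg n, g x ∈ W'.deg (n + b)) {n m : ℤ} (hm : n + a + b = m)
    {x : V ⊗[k] W} (hx : x ∈ tensorDeg V W n) :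
    TensorProduct.map f g x ∈ tensorDeg V' W' m := by
  have : tensorDeg V W n ≤ (tensorDeg V' W' m).comap (TensorProduct.map f g) := by
    refine tensorDeg_le V W fun p q h x hx y hy => ?_
    rw [Submodule.mem_comap, TensorProduct.map_tmul]
    exact tmul_mem V' W' (by omega) (hf p x hx) (hg q y hy)
  exact this hx

theorem parity_tensor (V W : DGModule.{u, v} k) :
    (tensor V W).parity = TensorProduct.map V.parity W.parity := by
  refine (tensor V W).hom_ext fun n x hx => ?_
  rw [parity_of_mem _ hx]
  have : tensorDeg V W n ≤ LinearMap.eqLocus (((n.negOnePow : ℤ) : k) • LinearMap.id)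
      (TensorProduct.map V.parity W.parity) := by
    refine tensorDeg_le V W fun p q h x hx' y hy => ?_
    subst h
    simp only [LinearMap.mem_eqLocus, LinearMap.smul_apply, LinearMap.id_apply,
      TensorProduct.map_tmul, V.parity_of_mem hx', W.parity_of_mem hy, TensorProduct.smul_tmul_smul,
      Int.negOnePow_add, Units.val_mul, Int.cast_mul]
  exact this hx

/-- A map of degree `0` commutes with the parity involutions. -/
theorem comp_parity {V W : DGModule.{u, v} k} {f : V →ₗ[k] W}
    (hf : ∀ n, ∀ x ∈ V.deg n, f x ∈ W.deg n) : f ∘ₗ V.parity = W.parity ∘ₗ f := by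
  refine V.hom_ext fun n x hx => ?_
  simp [V.parity_of_mem hx, W.parity_of_mem (hf n x hx)]

section Total

variable (X : ℕ → DGModule.{u, v} k) (β : ∀ n, X n →ₗ[k] X (n + 1))

/-- `(⨁ n, X_n)_p = ⨁ n, (X_n)_{p - n}`. -/
def totalDeg (p : ℤ) : Submodule k (⨁ n, X n) :=
  ⨆ n : ℕ, ((X n).deg (p - n)).map (DirectSum.lof k ℕ (fun n => X n) n)

/-- On `X_n` the differential is `(-1)^n d + β`. -/
def totalD : (⨁ n, X n) →ₗ[k] ⨁ n, X n :=
  DirectSum.toModule k ℕ _ fun n =>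
    (-1 : k) ^ n • (DirectSum.lof k ℕ (fun n => X n) n ∘ₗ (X n).d) +
      DirectSum.lof k ℕ (fun n => X n) (n + 1) ∘ₗ β n

theorem lof_mem_totalDeg {n : ℕ} {p q : ℤ} (h : q + n = p) {x : X n} (hx : x ∈ (X n).deg q) :
    DirectSum.lof k ℕ (fun n => X n) n x ∈ totalDeg X p := by
  obtain rfl : q = p - n := by omega
  exact Submodule.mem_iSup_of_mem n (Submodule.mem_map_of_mem hx)

theorem totalDeg_le {p : ℤ} {S : Submodule k (⨁ n, X n)}
    (h : ∀ (n : ℕ) (q : ℤ), q + n = p → ∀ x ∈ (X n).deg q,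
      DirectSum.lof k ℕ (fun n => X n) n x ∈ S) : totalDeg X p ≤ S :=
  iSup_le fun n => Submodule.map_le_iff_le_comap.2 fun x hx => h n (p - n) (by omega) x hx

theorem iSup_totalDeg : iSup (totalDeg X) = ⊤ := by
  rw [eq_top_iff]
  rintro x -
  induction x using DirectSum.induction_on with
  | zero => exact Submodule.zero_mem _
  | of n x =>
    have h : (⊤ : Submodule k (X n)) ≤
        (iSup (totalDeg X)).comap (DirectSum.lof k ℕ (fun n => X n) n) := by
      rw [← (X n).isInternal.submodule_iSup_eq_top]
      exact iSup_le fun q x hx =>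
        Submodule.mem_iSup_of_mem (q + n) (lof_mem_totalDeg X rfl hx)
    exact h Submodule.mem_top
  | add x y hx hy => exact Submodule.add_mem _ hx hy

theorem isInternal_totalDeg : DirectSum.IsInternal (totalDeg X) := by
  let Φ : (⨁ n, X n) →ₗ[k] (ℤ →₀ ⨁ n, X n) :=
    DirectSum.toModule k ℕ _ fun n =>
      Finsupp.mapRange.linearMap (DirectSum.lof k ℕ (fun n => X n) n) ∘ₗ
        Finsupp.lmapDomain (X n) k (fun q : ℤ => q + n) ∘ₗ (X n).comps
  refine isInternal_of_split _ (iSup_totalDeg X) Φ fun p x hx => ?_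
  have : totalDeg X p ≤ LinearMap.eqLocus Φ (Finsupp.lsingle p) := by
    refine totalDeg_le X fun n q h x hx => ?_
    simp [Φ, (X n).comps_of_mem hx, Finsupp.mapDomain_single, h]
  exact this hx

variable (hβ : ∀ (n : ℕ) (p : ℤ) (x : X n), x ∈ (X n).deg p → β n x ∈ (X (n + 1)).deg p)
  (hd : ∀ n, β n ∘ₗ (X n).d = (X (n + 1)).d ∘ₗ β n) (hββ : ∀ n, β (n + 1) ∘ₗ β n = 0)

/-- The total complex `⨁ n, X_n` of a sequence `X_0 → X_1 → X_2 → ⋯` of morphisms `β_n` of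
differential graded vector spaces with `β_{n+1} β_n = 0`; the summand `X_n` is shifted by `n`. -/
abbrev total : DGModule.{u, v} k where
  carrier := ⨁ n, X n
  deg := totalDeg X
  isInternal := isInternal_totalDeg X
  d := totalD X β
  d_mem := by
    intro p x hx
    have : totalDeg X p ≤ (totalDeg X (p + 1)).comap (totalD X β) := by
      refine totalDeg_le X fun n q h x hx => ?_
      rw [Submodule.mem_comap, totalD, DirectSum.toModule_lof]
      exact Submodule.add_mem _
        (Submodule.smul_mem _ _ (lof_mem_totalDeg X (by omega) ((X n).d_mem hx)))
        (lof_mem_totalDeg X (by push_cast; omega) (hβ n q x hx))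
    exact this hx
  d_comp_d := by
    refine DirectSum.linearMap_ext _ fun n => LinearMap.ext fun x => ?_
    have h1 : (X n).d ((X n).d x) = 0 := LinearMap.congr_fun (X n).d_comp_d x
    have h2 : β n ((X n).d x) = (X (n + 1)).d (β n x) := LinearMap.congr_fun (hd n) x
    have h3 : β (n + 1) (β n x) = 0 := LinearMap.congr_fun (hββ n) x
    simp [totalD, h1, h2, h3, pow_succ]

end Total

end DGModule

namespace DGCoalgebra

open DGModule

variable (C : DGCoalgebra.{u, v} k)

theorem comul_comp_parity : Coalgebra.comul (R := k) ∘ₗ C.parity =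
    TensorProduct.map C.parity C.parity ∘ₗ Coalgebra.comul (R := k) := by
  rw [← parity_tensor]
  exact comp_parity (V := C.toDGModule) (W := tensor C.toDGModule C.toDGModule)
    fun n x hx => C.comul_mem hx

theorem counit_comp_parity :
    Coalgebra.counit (R := k) ∘ₗ C.parity = Coalgebra.counit (R := k) (A := C.carrier) := by
  have h : ∀ (n : ℤ), C.deg n ≤ LinearMap.eqLocus (Coalgebra.counit (R := k) ∘ₗ C.parity)
      (Coalgebra.counit (R := k) (A := C.carrier)) := by
    intro n x hx
    rw [LinearMap.mem_eqLocus, LinearMap.comp_apply, C.parity_of_mem hx, map_smul]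
    by_cases hn : n = 0
    · simp [hn]
    · simp [C.counit_of_mem hx hn]
  refine LinearMap.ext fun x => (iSup_le h) ?_
  rw [C.isInternal.submodule_iSup_eq_top]
  exact Submodule.mem_top

/-- Coassociativity of `Δ ⊗ id`. -/
theorem comulTensor_comp_comulTensor (W : Type v) [AddCommGroup W] [Module k W] :
    C.comulTensor (C.carrier ⊗[k] W) ∘ₗ C.comulTensor W =
      TensorProduct.map LinearMap.id (C.comulTensor W) ∘ₗ C.comulTensor W := by
  refine TensorProduct.ext' fun c w => ?_
  let F : C.carrier ⊗[k] (C.carrier ⊗[k] C.carrier) →ₗ[k]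
      C.carrier ⊗[k] (C.carrier ⊗[k] (C.carrier ⊗[k] W)) :=
    TensorProduct.map LinearMap.id (TensorProduct.map LinearMap.id ((TensorProduct.mk k _ W).flip w))
  have h1 : ∀ t : C.carrier ⊗[k] C.carrier,
      C.comulTensor (C.carrier ⊗[k] W) (TensorProduct.assoc k _ _ _ (t ⊗ₜ[k] w)) =
        F (TensorProduct.assoc k _ _ _ (TensorProduct.map Coalgebra.comul LinearMap.id t)) := by
    intro t
    induction t with
    | zero => simp
    | add x y hx hy => simp only [TensorProduct.add_tmul, map_add, hx, hy]
    | tmul a b =>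
      simp only [comulTensor, TensorProduct.assoc_tmul, LinearMap.comp_apply, TensorProduct.map_tmul,
        LinearMap.id_apply, LinearEquiv.coe_coe]
      generalize (Coalgebra.comul (R := k) a) = s
      induction s with
      | zero => simp
      | add x y hx hy => simp only [TensorProduct.add_tmul, map_add, hx, hy]
      | tmul x y => simp [F]
  have h2 : ∀ t : C.carrier ⊗[k] C.carrier,
      TensorProduct.map LinearMap.id (C.comulTensor W) (TensorProduct.assoc k _ _ _ (t ⊗ₜ[k] w)) =
        F (TensorProduct.map LinearMap.id Coalgebra.comul t) := by
    intro t
    induction t with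
    | zero => simp
    | add x y hx hy => simp only [TensorProduct.add_tmul, map_add, hx, hy]
    | tmul a b =>
      simp only [comulTensor, TensorProduct.assoc_tmul, LinearMap.comp_apply, TensorProduct.map_tmul,
        LinearMap.id_apply, LinearEquiv.coe_coe, F]
      congr 1
      generalize (Coalgebra.comul (R := k) b) = s
      induction s with
      | zero => simp
      | add x y hx hy => simp only [TensorProduct.add_tmul, map_add, hx, hy]
      | tmul x y => simp
  have h3 := Coalgebra.coassoc_apply (R := k) c
  have h4 : C.comulTensor W (c ⊗ₜ[k] w) =
      TensorProduct.assoc k _ _ _ (Coalgebra.comul (R := k) c ⊗ₜ[k] w) := rfl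
  rw [LinearMap.comp_apply, LinearMap.comp_apply, h4, h1, h2]
  exact congrArg F h3

/-- Naturality of `Δ ⊗ id`. -/
theorem comulTensor_naturality {W W' : Type v} [AddCommGroup W] [Module k W] [AddCommGroup W']
    [Module k W'] (f : W →ₗ[k] W') :
    C.comulTensor W' ∘ₗ TensorProduct.map LinearMap.id f =
      TensorProduct.map LinearMap.id (TensorProduct.map LinearMap.id f) ∘ₗ C.comulTensor W := by
  refine TensorProduct.ext' fun c w => ?_
  simp only [comulTensor, LinearMap.comp_apply, TensorProduct.map_tmul, LinearMap.id_apply,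
    LinearEquiv.coe_coe]
  generalize (Coalgebra.comul (R := k) c) = s
  induction s with
  | zero => simp
  | add x y hx hy => simp only [TensorProduct.add_tmul, map_add, hx, hy]
  | tmul x y => simp

theorem comulTensor_mem (W : DGModule.{u, v} k) {n : ℤ} {x : C.carrier ⊗[k] W}
    (hx : x ∈ tensorDeg C.toDGModule W n) :
    C.comulTensor W x ∈ tensorDeg C.toDGModule (tensor C.toDGModule W) n := by
  have : tensorDeg C.toDGModule W n ≤
      (tensorDeg C.toDGModule (tensor C.toDGModule W) n).comap (C.comulTensor W) := by
    refine tensorDeg_le _ _ fun p q h x hx y hy => ?_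
    have h1 : tensorDeg C.toDGModule C.toDGModule p ≤
        (tensorDeg C.toDGModule (tensor C.toDGModule W) n).comap
          ((TensorProduct.assoc k C.carrier C.carrier W).toLinearMap ∘ₗ
            (TensorProduct.mk k _ W.carrier).flip y) := by
      refine tensorDeg_le _ _ fun p' q' h' x' hx' y' hy' => ?_
      exact tmul_mem _ _ (q := q' + q) (by omega) hx' (tmul_mem _ _ rfl hy' hy)
    exact h1 (C.comul_mem hx)
  exact this hx

theorem comulTensor_comp_d (W : DGModule.{u, v} k) :
    C.comulTensor W ∘ₗ tensorD C.toDGModule W =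
      tensorD C.toDGModule (tensor C.toDGModule W) ∘ₗ C.comulTensor W := by
  refine TensorProduct.ext' fun c w => ?_
  have h1 : Coalgebra.comul (R := k) (C.d c) =
      tensorD C.toDGModule C.toDGModule (Coalgebra.comul c) := LinearMap.congr_fun C.comul_comp_d c
  have h2 : Coalgebra.comul (R := k) (C.parity c) =
      TensorProduct.map C.parity C.parity (Coalgebra.comul (R := k) c) :=
    LinearMap.congr_fun C.comul_comp_parity c
  simp only [comulTensor, LinearMap.comp_apply, TensorProduct.map_tmul, LinearMap.id_apply,
    LinearEquiv.coe_coe, tensorD, LinearMap.add_apply, map_add, h1, h2]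
  generalize (Coalgebra.comul (R := k) c) = s
  induction s with
  | zero => simp
  | add x y hx hy =>
    simp only [TensorProduct.add_tmul, map_add] at hx hy ⊢
    rw [add_add_add_comm, add_add_add_comm (TensorProduct.map _ _ _), ← hx, ← hy]
    abel
  | tmul x y =>
    simp [TensorProduct.add_tmul, TensorProduct.tmul_add, add_assoc]

end DGCoalgebra

namespace DGPrecomodule

open DGModule

theorem map_id_comp_tensorD {V W W' : DGModule.{u, v} k} {f : W →ₗ[k] W'}
    (hf : f ∘ₗ W.d = W'.d ∘ₗ f) :
    TensorProduct.map LinearMap.id f ∘ₗ tensorD V W =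
      tensorD V W' ∘ₗ TensorProduct.map LinearMap.id f := by
  refine TensorProduct.ext' fun x y => ?_
  have h : f (W.d y) = W'.d (f y) := LinearMap.congr_fun hf y
  simp [tensorD, h]

theorem map_id_mem {V W W' : DGModule.{u, v} k} {f : W →ₗ[k] W'}
    (hf : ∀ n, ∀ x ∈ W.deg n, f x ∈ W'.deg n) {n : ℤ} {x : V ⊗[k] W}
    (hx : x ∈ tensorDeg V W n) :
    TensorProduct.map LinearMap.id f x ∈ tensorDeg V W' n :=
  map_mem_tensorDeg (a := 0) (b := 0) (fun n x hx => by simpa using hx)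
    (fun n x hx => by simpa using hf n x hx) (by omega) hx

theorem map_id_sub {A B B' : Type v} [AddCommGroup A] [Module k A] [AddCommGroup B] [Module k B]
    [AddCommGroup B'] [Module k B'] (f g : B →ₗ[k] B') :
    TensorProduct.map (LinearMap.id : A →ₗ[k] A) (f - g) =
      TensorProduct.map LinearMap.id f - TensorProduct.map LinearMap.id g :=
  LinearMap.lTensor_sub f g

theorem map_id_comp {A B B' B'' : Type v} [AddCommGroup A] [Module k A] [AddCommGroup B]
    [Module k B] [AddCommGroup B'] [Module k B'] [AddCommGroup B''] [Module k B'']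
    (g : B' →ₗ[k] B'') (f : B →ₗ[k] B') :
    TensorProduct.map (LinearMap.id : A →ₗ[k] A) (g ∘ₗ f) =
      TensorProduct.map LinearMap.id g ∘ₗ TensorProduct.map LinearMap.id f :=
  LinearMap.lTensor_comp A g f

/-- `Δ ⊗ id - id ⊗ b : C ⊗ W → C ⊗ (C ⊗ W)`, where `b : W → C ⊗ W` is the structure map of `W`. -/
def bar (W : DGPrecomodule.{u, v} C) :
    C.carrier ⊗[k] W.carrier →ₗ[k] C.carrier ⊗[k] (C.carrier ⊗[k] W.carrier) :=
  C.comulTensor W.carrier - TensorProduct.map LinearMap.id W.coact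

theorem bar_comp_coact (W : DGPrecomodule.{u, v} C) : W.bar ∘ₗ W.coact = 0 := by
  rw [bar, LinearMap.sub_comp, W.coassoc, sub_self]

theorem comulTensor_comp_bar (W : DGPrecomodule.{u, v} C) :
    C.comulTensor (C.carrier ⊗[k] W.carrier) ∘ₗ W.bar =
      TensorProduct.map LinearMap.id W.bar ∘ₗ C.comulTensor W.carrier := by
  rw [bar, map_id_sub, LinearMap.comp_sub, LinearMap.sub_comp, C.comulTensor_comp_comulTensor,
    C.comulTensor_naturality]

theorem bar_mem (W : DGPrecomodule.{u, v} C) {n : ℤ} {x : C.carrier ⊗[k] W.carrier}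
    (hx : x ∈ tensorDeg C.toDGModule W.toDGModule n) :
    W.bar x ∈ tensorDeg C.toDGModule (tensor C.toDGModule W.toDGModule) n :=
  Submodule.sub_mem _ (C.comulTensor_mem W.toDGModule hx)
    (map_id_mem (W' := tensor C.toDGModule W.toDGModule) (fun _ _ h => W.coact_mem h) hx)

theorem bar_comp_d (W : DGPrecomodule.{u, v} C) :
    W.bar ∘ₗ tensorD C.toDGModule W.toDGModule =
      tensorD C.toDGModule (tensor C.toDGModule W.toDGModule) ∘ₗ W.bar := by
  rw [bar, LinearMap.sub_comp, LinearMap.comp_sub, C.comulTensor_comp_d W.toDGModule,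
    map_id_comp_tensorD (W' := tensor C.toDGModule W.toDGModule) W.coact_comp_d]

/-- For `W` with structure map `b : W → C ⊗ W`, the space `C ⊗ W` with the structure map
`Δ ⊗ id - id ⊗ b : C ⊗ W → C ⊗ (C ⊗ W)`. -/
abbrev step (W : DGPrecomodule.{u, v} C) : DGPrecomodule.{u, v} C where
  toDGModule := tensor C.toDGModule W.toDGModule
  coact := W.bar
  coact_mem := W.bar_mem
  coact_comp_d := W.bar_comp_d
  coassoc := by
    have h : TensorProduct.map (LinearMap.id : C.carrier →ₗ[k] C.carrier) W.bar ∘ₗ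
        TensorProduct.map LinearMap.id W.coact = 0 := by
      rw [← map_id_comp, W.bar_comp_coact, TensorProduct.map_zero_right]
    rw [W.comulTensor_comp_bar]
    conv_rhs => rw [bar, LinearMap.comp_sub]
    exact (sub_eq_self.2 h).symm

/-- `C ⊗ f : C ⊗ W → C ⊗ W'`. -/
abbrev stepMap {W W' : DGPrecomodule.{u, v} C} (f : Hom W W') : Hom W.step W'.step where
  lin := TensorProduct.map LinearMap.id f.lin
  map_mem := fun hx => map_id_mem (fun _ _ h => f.map_mem h) hx
  comp_d := map_id_comp_tensorD f.comp_d
  colinear := by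
    change W'.bar ∘ₗ _ = _ ∘ₗ W.bar
    rw [bar, bar, LinearMap.sub_comp, LinearMap.comp_sub, C.comulTensor_naturality,
      ← map_id_comp, ← map_id_comp, f.colinear]

end DGPrecomodule

namespace DGComodule

open DGModule

/-- `C^{⊗ n} ⊗ M` (with `C^{⊗ (n + 1)} ⊗ M = C ⊗ (C^{⊗ n} ⊗ M)`), together with the map
`b' : C^{⊗ n} ⊗ M → C^{⊗ (n + 1)} ⊗ M`,
`b' (c_1, …, c_n, m) = ∑_{i = 1}^{n + 1} (-1)^{i + 1} (c_1, …, Δ c_i, …, c_n, m)`,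
where `c_{n + 1} = m` and `Δ m = ρ m`, as its structure map. -/
def power (M : DGComodule.{u, v} C) : ℕ → DGPrecomodule.{u, v} C
  | 0 => M.toDGPrecomodule
  | n + 1 => (power M n).step

/-- The map `C^{⊗ n} ⊗ M → C^{⊗ n} ⊗ N` induced by `M → N`. -/
def powerMap {M N : DGComodule.{u, v} C} (f : M ⟶ N) :
    ∀ n : ℕ, DGPrecomodule.Hom (M.power n) (N.power n)
  | 0 => f
  | n + 1 => DGPrecomodule.stepMap (powerMap f n)

/-- The summand `C^{⊗ (n + 1)} ⊗ M = C ⊗ (C^{⊗ n} ⊗ M)` of the standard resolution. -/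
abbrev summand (M : DGComodule.{u, v} C) (n : ℕ) : DGModule.{u, v} k :=
  tensor C.toDGModule (M.power n).toDGModule

/-- The map `b'` from `C^{⊗ (n + 1)} ⊗ M` to `C^{⊗ (n + 2)} ⊗ M`. -/
def bPrime (M : DGComodule.{u, v} C) (n : ℕ) : M.summand n →ₗ[k] M.summand (n + 1) :=
  (M.power n).bar

/-- The inclusion of the summand `C^{⊗ (n + 1)} ⊗ M`. -/
abbrev incl (M : DGComodule.{u, v} C) (n : ℕ) : M.summand n →ₗ[k] ⨁ n, M.summand n :=
  DirectSum.lof k ℕ (fun n => M.summand n) n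

/-- The complex underlying the standard resolution: `⨁_{n ≥ 0} C^{⊗ (n + 1)} ⊗ M`, where
`(c_1, …, c_{n + 1}, m)` has degree `|c_1| + ⋯ + |c_{n + 1}| + |m| + n`, with differential
`(-1)^n d + b'` on the summand of index `n`. -/
abbrev cobarComplex (M : DGComodule.{u, v} C) : DGModule.{u, v} k :=
  DGModule.total M.summand M.bPrime
    (fun n _ _ hx => (M.power n).bar_mem hx)
    (fun n => (M.power n).bar_comp_d)
    (fun n => (M.power (n + 1)).bar_comp_coact)

/-- The coaction of the standard resolution,
`(c_1, …, c_{n + 1}, m) ↦ ∑ (-1)^{n |c_1'|} c_1' ⊗ (c_1'', c_2, …, c_{n + 1}, m)`; the sign is the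
Koszul sign that comes from the shift by `n`. -/
def cobarCoact (M : DGComodule.{u, v} C) :
    (⨁ n, M.summand n) →ₗ[k] C.carrier ⊗[k] ⨁ n, M.summand n :=
  DirectSum.toModule k ℕ _ fun n =>
    TensorProduct.map (C.parity ^ n) (M.incl n) ∘ₗ C.comulTensor (M.power n).carrier

theorem cobarCoact_incl (M : DGComodule.{u, v} C) (n : ℕ) (x : M.summand n) :
    M.cobarCoact (M.incl n x) = TensorProduct.map (C.parity ^ n) (M.incl n)
      (C.comulTensor (M.power n).carrier x) := by
  rw [cobarCoact, DirectSum.toModule_lof, LinearMap.comp_apply]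

theorem cobarComplex_d_incl (M : DGComodule.{u, v} C) (n : ℕ) (x : M.summand n) :
    M.cobarComplex.d (M.incl n x) =
      (-1 : k) ^ n • M.incl n ((M.summand n).d x) + M.incl (n + 1) (M.bPrime n x) := by
  change totalD _ _ _ = _
  rw [totalD, DirectSum.toModule_lof]
  rfl

theorem parity_pow_mem (V : DGModule.{u, v} k) (j : ℕ) {n : ℤ} {x : V} (hx : x ∈ V.deg n) :
    (V.parity ^ j) x ∈ V.deg n := by
  induction j with
  | zero => simpa using hx
  | succ j ih => rw [pow_succ', Module.End.mul_apply]; exact V.parity_mem ih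

theorem parity_pow_d (V : DGModule.{u, v} k) (j : ℕ) (x : V) :
    (V.parity ^ j) (V.d x) = (-1 : k) ^ j • V.d ((V.parity ^ j) x) := by
  induction j with
  | zero => simp
  | succ j ih =>
    have h : ∀ y, V.parity (V.d y) = -V.d (V.parity y) := LinearMap.congr_fun V.parity_comp_d
    simp [pow_succ', ih, h]

theorem cobarCoact_mem (M : DGComodule.{u, v} C) {p : ℤ} {x : ⨁ n, M.summand n}
    (hx : x ∈ totalDeg M.summand p) :
    M.cobarCoact x ∈ tensorDeg C.toDGModule M.cobarComplex p := by
  have : totalDeg M.summand p ≤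
      (tensorDeg C.toDGModule M.cobarComplex p).comap M.cobarCoact := by
    refine totalDeg_le _ fun n q h x hx => ?_
    rw [Submodule.mem_comap, cobarCoact, DirectSum.toModule_lof]
    exact map_mem_tensorDeg (a := 0) (b := n) (W' := M.cobarComplex)
      (fun m x hx => by simpa using parity_pow_mem C.toDGModule n hx)
      (fun m x hx => lof_mem_totalDeg M.summand rfl hx) (by omega)
      (C.comulTensor_mem (M.power n).toDGModule hx)
  exact this hx

theorem cobarCoact_comp_d (M : DGComodule.{u, v} C) :
    M.cobarCoact ∘ₗ M.cobarComplex.d =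
      tensorD C.toDGModule M.cobarComplex ∘ₗ M.cobarCoact := by
  refine DirectSum.linearMap_ext _ fun n => LinearMap.ext fun x => ?_
  have h1 : C.comulTensor (M.power n).carrier (tensorD C.toDGModule (M.power n).toDGModule x) =
      tensorD C.toDGModule (M.summand n) (C.comulTensor (M.power n).carrier x) :=
    LinearMap.congr_fun (C.comulTensor_comp_d (M.power n).toDGModule) x
  have h2 : C.comulTensor (M.power (n + 1)).carrier (M.bPrime n x) =
      TensorProduct.map LinearMap.id (M.bPrime n) (C.comulTensor (M.power n).carrier x) :=
    LinearMap.congr_fun (M.power n).comulTensor_comp_bar x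
  simp only [LinearMap.comp_apply, totalD, cobarCoact, DirectSum.toModule_lof, LinearMap.add_apply,
    LinearMap.smul_apply, map_add, map_smul, h1, h2]
  generalize C.comulTensor (M.power n).carrier x = s
  induction s with
  | zero => simp
  | add x y hx hy =>
    simp only [map_add, smul_add] at hx hy ⊢
    rw [add_add_add_comm, hx, hy]
  | tmul a b =>
    have h3 := parity_pow_d C.toDGModule n a
    have h4 : (C.parity ^ n) (C.parity a) = C.parity ((C.parity ^ n) a) := by
      rw [← Module.End.mul_apply, ← Module.End.mul_apply, ← pow_succ, ← pow_succ']
    have h5 : (-1 : k) ^ n * (-1 : k) ^ n = 1 := by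
      rw [← mul_pow]; simp
    simp only [tensorD, LinearMap.add_apply, TensorProduct.map_tmul, LinearMap.id_apply, map_add,
      smul_add, h3, h4, TensorProduct.smul_tmul', smul_smul, h5, one_smul, totalD,
      DirectSum.toModule_lof, LinearMap.smul_apply, LinearMap.comp_apply, TensorProduct.tmul_add,
      TensorProduct.tmul_smul, pow_succ', Module.End.mul_apply, add_assoc]

theorem comul_parity_pow (C : DGCoalgebra.{u, v} k) (j : ℕ) (a : C.carrier) :
    Coalgebra.comul (R := k) ((C.parity ^ j) a) =
      TensorProduct.map (C.parity ^ j) (C.parity ^ j) (Coalgebra.comul (R := k) a) := by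
  induction j with
  | zero => simp [Module.End.one_eq_id]
  | succ j ih =>
    have h : ∀ y, Coalgebra.comul (R := k) (C.parity y) =
      TensorProduct.map C.parity C.parity (Coalgebra.comul (R := k) y) :=
      LinearMap.congr_fun C.comul_comp_parity
    rw [pow_succ', Module.End.mul_apply, h, ih, Module.End.mul_eq_comp, TensorProduct.map_comp,
      LinearMap.comp_apply]

theorem counit_parity_pow (C : DGCoalgebra.{u, v} k) (j : ℕ) (a : C.carrier) :
    Coalgebra.counit (R := k) ((C.parity ^ j) a) = Coalgebra.counit (R := k) a := by
  induction j with
  | zero => simp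
  | succ j ih =>
    have h : ∀ y, Coalgebra.counit (R := k) (C.parity y) = Coalgebra.counit (R := k) y :=
      LinearMap.congr_fun C.counit_comp_parity
    rw [pow_succ', Module.End.mul_apply, h, ih]

theorem cobarCoact_coassoc (M : DGComodule.{u, v} C) :
    C.comulTensor (⨁ n, M.summand n) ∘ₗ M.cobarCoact =
      TensorProduct.map LinearMap.id M.cobarCoact ∘ₗ M.cobarCoact := by
  refine DirectSum.linearMap_ext _ fun n => LinearMap.ext fun x => ?_
  have h1 : C.comulTensor (C.carrier ⊗[k] (M.power n).carrier) (C.comulTensor (M.power n).carrier x) =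
      TensorProduct.map LinearMap.id (C.comulTensor (M.power n).carrier)
        (C.comulTensor (M.power n).carrier x) :=
    LinearMap.congr_fun (C.comulTensor_comp_comulTensor (M.power n).carrier) x
  have h2 : ∀ s : C.carrier ⊗[k] (M.summand n).carrier,
      C.comulTensor (⨁ n, M.summand n) (TensorProduct.map (C.parity ^ n) (M.incl n) s) =
        TensorProduct.map (C.parity ^ n) (TensorProduct.map (C.parity ^ n) (M.incl n))
          (C.comulTensor (M.summand n).carrier s) := by
    intro s
    induction s with
    | zero => simp
    | add x y hx hy => simp only [map_add, hx, hy]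
    | tmul a b =>
      simp only [DGCoalgebra.comulTensor, LinearMap.comp_apply, TensorProduct.map_tmul,
        LinearMap.id_apply, LinearEquiv.coe_coe, comul_parity_pow]
      generalize (Coalgebra.comul (R := k) a) = t
      induction t with
      | zero => simp
      | add x y hx hy => simp only [TensorProduct.add_tmul, map_add, hx, hy]
      | tmul x y => simp
  have h3 : ∀ s : C.carrier ⊗[k] (M.summand n).carrier,
      TensorProduct.map LinearMap.id M.cobarCoact (TensorProduct.map (C.parity ^ n) (M.incl n) s) =
        TensorProduct.map (C.parity ^ n) (TensorProduct.map (C.parity ^ n) (M.incl n))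
          (TensorProduct.map LinearMap.id (C.comulTensor (M.power n).carrier) s) := by
    intro s
    induction s with
    | zero => simp
    | add x y hx hy => simp only [map_add, hx, hy]
    | tmul a b =>
      simp only [TensorProduct.map_tmul, LinearMap.id_apply, cobarCoact, DirectSum.toModule_lof,
        LinearMap.comp_apply]
  have h4 := M.cobarCoact_incl n x
  rw [LinearMap.comp_apply, LinearMap.comp_apply, LinearMap.comp_apply, LinearMap.comp_apply, h4,
    h2, h3]
  exact congrArg _ h1

/-- The standard resolution `C(M)`. -/
def cobar (M : DGComodule.{u, v} C) : DGComodule.{u, v} C where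
  toDGModule := M.cobarComplex
  coact := M.cobarCoact
  coact_mem := M.cobarCoact_mem
  coact_comp_d := M.cobarCoact_comp_d
  coassoc := M.cobarCoact_coassoc
  counit_coact := by
    refine DirectSum.linearMap_ext _ fun n => TensorProduct.ext' fun c w => ?_
    have h4 := M.cobarCoact_incl n (c ⊗ₜ[k] w)
    have h5 : ∀ t : C.carrier ⊗[k] C.carrier,
        TensorProduct.lid k _ (TensorProduct.map Coalgebra.counit LinearMap.id
          (TensorProduct.map (C.parity ^ n) (M.incl n)
            (TensorProduct.assoc k _ _ _ (t ⊗ₜ[k] w)))) =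
          M.incl n (TensorProduct.lid k _
            (TensorProduct.map Coalgebra.counit LinearMap.id t) ⊗ₜ[k] w) := by
      intro t
      induction t with
      | zero => simp
      | add x y hx hy => simp only [TensorProduct.add_tmul, map_add, hx, hy]
      | tmul x y =>
        simp only [TensorProduct.assoc_tmul, TensorProduct.map_tmul, counit_parity_pow,
          LinearMap.id_apply, TensorProduct.lid_tmul, ← TensorProduct.smul_tmul', map_smul]
    have h6 : TensorProduct.lid k _ (TensorProduct.map Coalgebra.counit LinearMap.id
        (Coalgebra.comul (R := k) c)) = c := by
      have := Coalgebra.rTensor_counit_comul (R := k) c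
      rw [LinearMap.rTensor] at this
      rw [this, TensorProduct.lid_tmul, one_smul]
    simp only [LinearMap.comp_apply, h4, LinearEquiv.coe_coe, LinearMap.id_apply]
    refine (h5 _).trans ?_
    rw [h6]

/-- The linear map underlying `C(M) → C(N)` for a morphism `f : M → N`, which is
`⨁ n, C^{⊗ (n + 1)} ⊗ f`. -/
def cobarMapLin {M N : DGComodule.{u, v} C} (f : M ⟶ N) :
    (⨁ n, M.summand n) →ₗ[k] ⨁ n, N.summand n :=
  DirectSum.toModule k ℕ _ fun n =>
    N.incl n ∘ₗ TensorProduct.map LinearMap.id (powerMap f n).lin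

theorem cobarMapLin_incl {M N : DGComodule.{u, v} C} (f : M ⟶ N) (n : ℕ) (x : M.summand n) :
    cobarMapLin f (M.incl n x) =
      N.incl n (TensorProduct.map LinearMap.id (powerMap f n).lin x) := by
  rw [cobarMapLin, DirectSum.toModule_lof, LinearMap.comp_apply]

/-- The morphism `C(M) → C(N)` induced by `M → N`. -/
def cobarMap {M N : DGComodule.{u, v} C} (f : M ⟶ N) : M.cobar ⟶ N.cobar where
  lin := cobarMapLin f
  map_mem := by
    intro p x hx
    have : totalDeg M.summand p ≤ (totalDeg N.summand p).comap (cobarMapLin f) := by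
      refine totalDeg_le _ fun n q h x hx => ?_
      rw [Submodule.mem_comap, cobarMapLin_incl]
      exact lof_mem_totalDeg N.summand h ((DGPrecomodule.stepMap (powerMap f n)).map_mem hx)
    exact this hx
  comp_d := by
    refine DirectSum.linearMap_ext _ fun n => LinearMap.ext fun x => ?_
    have h1 : TensorProduct.map LinearMap.id (powerMap f n).lin ((M.summand n).d x) =
        (N.summand n).d (TensorProduct.map LinearMap.id (powerMap f n).lin x) :=
      LinearMap.congr_fun (DGPrecomodule.stepMap (powerMap f n)).comp_d x
    have h2 : TensorProduct.map LinearMap.id (powerMap f (n + 1)).lin (M.bPrime n x) =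
        N.bPrime n (TensorProduct.map LinearMap.id (powerMap f n).lin x) :=
      (LinearMap.congr_fun (DGPrecomodule.stepMap (powerMap f n)).colinear x).symm
    change cobarMapLin f (M.cobarComplex.d (M.incl n x)) =
      N.cobarComplex.d (cobarMapLin f (M.incl n x))
    rw [cobarMapLin_incl, cobarComplex_d_incl, cobarComplex_d_incl, map_add, map_smul,
      cobarMapLin_incl, cobarMapLin_incl, h1, h2]
  colinear := by
    refine DirectSum.linearMap_ext _ fun n => LinearMap.ext fun x => ?_
    have h1 := LinearMap.congr_fun (C.comulTensor_naturality (powerMap f n).lin) x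
    change N.cobarCoact (cobarMapLin f (M.incl n x)) =
      TensorProduct.map LinearMap.id (cobarMapLin f) (M.cobarCoact (M.incl n x))
    rw [cobarMapLin_incl, cobarCoact_incl, cobarCoact_incl]
    refine (congrArg _ h1).trans ?_
    rw [LinearMap.comp_apply]
    generalize C.comulTensor (M.power n).carrier x = s
    induction s with
    | zero => simp
    | add x y hx hy => simp only [map_add, hx, hy]
    | tmul a b =>
      simp only [TensorProduct.map_tmul, LinearMap.id_apply]
      rw [cobarMapLin_incl]

/-- The coaction `ρ : M → C ⊗ M`, with values in the first summand of `C(M)`. -/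
def coactZero (M : DGComodule.{u, v} C) : M.carrier →ₗ[k] M.summand 0 := M.coact

/-- The morphism `M → C ⊗ M ⊆ C(M)` given by the coaction of `M`. -/
def cobarUnit (M : DGComodule.{u, v} C) : M ⟶ M.cobar where
  lin := M.incl 0 ∘ₗ M.coactZero
  map_mem := fun hx => lof_mem_totalDeg M.summand (n := 0) (by simp) (M.coact_mem hx)
  comp_d := by
    refine LinearMap.ext fun x => ?_
    have h1 : M.coactZero (M.d x) = (M.summand 0).d (M.coactZero x) :=
      LinearMap.congr_fun M.coact_comp_d x
    have h2 : M.bPrime 0 (M.coactZero x) = 0 :=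
      LinearMap.congr_fun M.toDGPrecomodule.bar_comp_coact x
    change M.incl 0 (M.coactZero (M.d x)) = M.cobarComplex.d (M.incl 0 (M.coactZero x))
    rw [cobarComplex_d_incl, h1, h2]
    simp
  colinear := by
    refine LinearMap.ext fun x => ?_
    have h1 : C.comulTensor (M.power 0).carrier (M.coactZero x) =
        TensorProduct.map LinearMap.id M.coactZero (M.coact x) := LinearMap.congr_fun M.coassoc x
    change M.cobarCoact (M.incl 0 (M.coactZero x)) =
      TensorProduct.map LinearMap.id (M.incl 0 ∘ₗ M.coactZero) (M.coact x)
    rw [cobarCoact_incl, h1, DGPrecomodule.map_id_comp, pow_zero, Module.End.one_eq_id]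
    rfl

theorem powerMap_id (M : DGComodule.{u, v} C) (n : ℕ) :
    (powerMap (𝟙 M) n).lin = LinearMap.id := by
  induction n with
  | zero => rfl
  | succ n ih =>
    change TensorProduct.map LinearMap.id (powerMap (𝟙 M) n).lin = LinearMap.id
    rw [ih, TensorProduct.map_id]

theorem powerMap_comp {M N P : DGComodule.{u, v} C} (f : M ⟶ N) (g : N ⟶ P) (n : ℕ) :
    (powerMap (f ≫ g) n).lin = (powerMap g n).lin ∘ₗ (powerMap f n).lin := by
  induction n with
  | zero => rfl
  | succ n ih =>
    change TensorProduct.map LinearMap.id (powerMap (f ≫ g) n).lin = _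
    rw [ih, DGPrecomodule.map_id_comp]
    rfl

end DGComodule

/-- The standard resolution as a functor `Chain(C) ⥤ Chain(C)`. -/
def cobarFunctor (C : DGCoalgebra.{u, v} k) : DGComodule.{u, v} C ⥤ DGComodule.{u, v} C where
  obj M := M.cobar
  map f := DGComodule.cobarMap f
  map_id M := by
    refine DGPrecomodule.Hom.ext (DirectSum.linearMap_ext _ fun n => LinearMap.ext fun x => ?_)
    change DGComodule.cobarMapLin (𝟙 M) (M.incl n x) = M.incl n x
    rw [DGComodule.cobarMapLin_incl, DGComodule.powerMap_id, TensorProduct.map_id,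
      LinearMap.id_apply]
  map_comp {M N P} f g := by
    refine DGPrecomodule.Hom.ext (DirectSum.linearMap_ext _ fun n => LinearMap.ext fun x => ?_)
    change DGComodule.cobarMapLin (f ≫ g) (M.incl n x) =
      DGComodule.cobarMapLin g (DGComodule.cobarMapLin f (M.incl n x))
    rw [DGComodule.cobarMapLin_incl, DGComodule.cobarMapLin_incl, DGComodule.cobarMapLin_incl,
      DGComodule.powerMap_comp, DGPrecomodule.map_id_comp, LinearMap.comp_apply]

/-- The natural morphism `M → C(M)`. -/
def cobarNat (C : DGCoalgebra.{u, v} k) :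
    𝟭 (DGComodule.{u, v} C) ⟶ cobarFunctor C where
  app M := M.cobarUnit
  naturality {M N} f := by
    refine DGPrecomodule.Hom.ext (LinearMap.ext fun x => ?_)
    have h : N.coactZero (f.lin x) =
        TensorProduct.map LinearMap.id (DGComodule.powerMap f 0).lin (M.coactZero x) :=
      LinearMap.congr_fun f.colinear x
    change N.incl 0 (N.coactZero (f.lin x)) = DGComodule.cobarMapLin f (M.incl 0 (M.coactZero x))
    rw [DGComodule.cobarMapLin_incl, h]

end DGCo

end

/-!
A colinear map into a cofree comodule `C ⊗ V` is determined by its composite with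
`ε ⊗ id : C ⊗ V → V`, which may be any linear map. An acyclic complex of vector spaces has a linear
contraction, so a colinear chain map from an acyclic comodule to `C ⊗ V` is null-homotopic.
The complex `C(M)` is filtered by the number of tensor factors, and the graded pieces are cofree.
If `C` is positively graded and `M` is left bounded, then the filtration is finite in each degree,
so the homotopies for the graded pieces add up: every morphism from an acyclic comodule to `C(M)`
is null-homotopic. Applied to the mapping cone of a quasi-isomorphism `s` and to its shift, this
shows that composition with `s` is bijective on homotopy classes of morphisms to `C(M)`, and hence
that `C(M)` is closed. Finally, `ε ⊗ id` contracts `C(M)` to `M`.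
-/

noncomputable section

open CategoryTheory TensorProduct DirectSum Filter

namespace DGCo

section Localization

variable {H : Type*} [Category H] {W : MorphismProperty H} {X : H}

theorem injective_Q_map_of_isLocal (hX : W.isLocal X) (N : H) :
    Function.Injective fun φ : N ⟶ X => W.Q.map φ := by
  have hinv : W.IsInvertedBy (yoneda.obj X).rightOp := fun A B s hs => by
    have : IsIso ((yoneda.obj X).map s.op) := (isIso_iff_bijective _).2 (hX s hs)
    change IsIso ((yoneda.obj X).map s.op).op
    infer_instance
  intro f g hfg
  have hop : (yoneda.obj X).rightOp.map f = (yoneda.obj X).rightOp.map g :=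
    congrArg (Localization.Construction.lift (yoneda.obj X).rightOp hinv).map hfg
  have hmap : (yoneda.obj X).map f.op = (yoneda.obj X).map g.op := congrArg Quiver.Hom.unop hop
  simpa using ConcreteCategory.congr_hom hmap (𝟙 X)

theorem exists_Q_map_eq_comp_of_isLocal (hX : W.isLocal X) {A B : W.Localization} (φ : A ⟶ B)
    (f : B.as.obj ⟶ X) : ∃ g : A.as.obj ⟶ X, W.Q.map g = φ ≫ W.Q.map f := by
  let P : MorphismProperty W.Localization := fun A B φ =>
    ∀ f : B.as.obj ⟶ X, ∃ g : A.as.obj ⟶ X, W.Q.map g = φ ≫ W.Q.map f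
  have : P.IsStableUnderComposition := ⟨fun φ ψ hφ hψ f => by
    obtain ⟨g, hg⟩ := hψ f
    obtain ⟨g', hg'⟩ := hφ g
    exact ⟨g', hg'.trans ((congrArg (φ ≫ ·) hg).trans (Category.assoc φ ψ _).symm)⟩⟩
  have hP : P = ⊤ := by
    refine Localization.Construction.morphismProperty_eq_top P (fun A B s f => ?_)
      fun A B s hs f => ?_
    · exact ⟨s ≫ f, W.Q.map_comp s f⟩
    · obtain ⟨g, rfl⟩ := (hX s hs).2 f
      exact ⟨g, (Iso.eq_inv_comp (Localization.Construction.wIso s hs)).2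
        (W.Q.map_comp s g).symm⟩
  have hφ : P φ := hP ▸ MorphismProperty.top_apply φ
  exact hφ f

theorem bijective_Q_map_of_isLocal (hX : W.isLocal X) (N : H) :
    Function.Bijective fun φ : N ⟶ X => W.Q.map φ := by
  refine ⟨injective_Q_map_of_isLocal hX N, fun φ => ?_⟩
  obtain ⟨f, hf⟩ := exists_Q_map_eq_comp_of_isLocal hX φ (𝟙 X)
  exact ⟨f, hf.trans ((congrArg (φ ≫ ·) (W.Q.map_id X)).trans (Category.comp_id φ))⟩

end Localization

section EventualMaps

variable {R ι V W : Type*} [AddCommMonoid V] [AddCommMonoid W] {l : Filter ι}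

theorem exists_linearMap_eventually_eq [Semiring R] [Module R V] [Module R W] [NeBot l]
    {s : ι → V →ₗ[R] W} (hs : ∀ x, EventuallyConst (fun i => s i x) l) :
    ∃ t : V →ₗ[R] W, ∀ x, ∀ᶠ i in l, s i x = t x := by
  have hlim : ∀ x, ∃ y, ∀ᶠ i in l, s i x = y := fun x =>
    eventuallyConst_iff_exists_eventuallyEq.1 (hs x)
  choose t ht using hlim
  exact ⟨{  toFun := t
            map_add' := fun x y => by
              obtain ⟨i, hxy, hx, hy⟩ := ((ht (x + y)).and ((ht x).and (ht y))).exists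
              rw [← hxy, ← hx, ← hy, map_add]
            map_smul' := fun c x => by
              obtain ⟨i, hcx, hx⟩ := ((ht (c • x)).and (ht x)).exists
              rw [← hcx, ← hx, map_smul, RingHom.id_apply] }, ht⟩

theorem eventually_map_apply_eq [CommSemiring R] [Module R V] [Module R W] {P Q : Type*}
    [AddCommMonoid P] [Module R P] [AddCommMonoid Q] [Module R Q] {s : ι → V →ₗ[R] W}
    {t : V →ₗ[R] W} (ht : ∀ x, ∀ᶠ i in l, s i x = t x) (σ : P →ₗ[R] Q) (z : P ⊗[R] V) :
    ∀ᶠ i in l, TensorProduct.map σ (s i) z = TensorProduct.map σ t z := by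
  induction z with
  | zero => simp
  | add y z hy hz => filter_upwards [hy, hz] with i hy hz using by rw [map_add, map_add, hy, hz]
  | tmul c x =>
    filter_upwards [ht x] with i hi using by
      rw [TensorProduct.map_tmul, TensorProduct.map_tmul, hi]

end EventualMaps

theorem exists_linearMap_comp_comp_eq {K V W : Type*} [DivisionRing K] [AddCommGroup V]
    [Module K V] [AddCommGroup W] [Module K W] (f : V →ₗ[K] W) :
    ∃ g : W →ₗ[K] V, f ∘ₗ g ∘ₗ f = f := by
  obtain ⟨r, hr⟩ := LinearMap.exists_rightInverse_of_surjective f.rangeRestrict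
    f.range_rangeRestrict
  obtain ⟨g, hg⟩ := LinearMap.exists_extend r
  refine ⟨g, LinearMap.ext fun x => ?_⟩
  have hgf : g (f x) = r (f.rangeRestrict x) := LinearMap.congr_fun hg (f.rangeRestrict x)
  rw [LinearMap.comp_apply, LinearMap.comp_apply, hgf]
  exact congrArg Subtype.val (LinearMap.congr_fun hr (f.rangeRestrict x))

theorem neg_one_pow_mul_self {R : Type*} [Monoid R] [HasDistribNeg R] (n : ℕ) :
    (-1 : R) ^ n * (-1 : R) ^ n = 1 := by
  rw [← pow_add, Even.neg_one_pow ⟨n, rfl⟩]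

variable {k : Type u} [Field k]

namespace DGModule

theorem comps_apply_mem (V : DGModule.{u, v} k) (x : V) (n : ℤ) : V.comps x n ∈ V.deg n := by
  have h : (⊤ : Submodule k V) ≤ (V.deg n).comap (Finsupp.lapply n ∘ₗ V.comps) := by
    rw [← V.isInternal.submodule_iSup_eq_top]
    refine iSup_le fun m x hx => ?_
    rw [Submodule.mem_comap, LinearMap.comp_apply, V.comps_of_mem hx, Finsupp.lapply_apply,
      Finsupp.single_apply]
    split_ifs with h
    · exact h ▸ hx
    · exact Submodule.zero_mem _
  exact h Submodule.mem_top

theorem comps_d (V : DGModule.{u, v} k) (x : V) (n : ℤ) :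
    V.comps (V.d x) (n + 1) = V.d (V.comps x n) := by
  have : Finsupp.lapply (n + 1) ∘ₗ V.comps ∘ₗ V.d = V.d ∘ₗ Finsupp.lapply n ∘ₗ V.comps := by
    refine V.hom_ext fun m x hx => ?_
    simp only [LinearMap.comp_apply, V.comps_of_mem hx, V.comps_of_mem (V.d_mem hx),
      Finsupp.lapply_apply, Finsupp.single_apply, add_left_inj]
    split_ifs <;> simp
  exact LinearMap.congr_fun this x

/-- The component of degree `r` of a linear map between graded vector spaces. -/
def homComponent {V W : DGModule.{u, v} k} (r : ℤ) (f : V →ₗ[k] W) : V →ₗ[k] W :=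
  Finsupp.lsum k (fun n : ℤ => Finsupp.lapply (n + r) ∘ₗ W.comps ∘ₗ f) ∘ₗ V.comps

theorem homComponent_of_mem {V W : DGModule.{u, v} k} (r : ℤ) (f : V →ₗ[k] W) {n : ℤ} {x : V}
    (hx : x ∈ V.deg n) : homComponent r f x = W.comps (f x) (n + r) := by
  simp [homComponent, V.comps_of_mem hx]

theorem homComponent_mem {V W : DGModule.{u, v} k} (r : ℤ) (f : V →ₗ[k] W) {n : ℤ} {x : V}
    (hx : x ∈ V.deg n) : homComponent r f x ∈ W.deg (n + r) := by
  rw [homComponent_of_mem r f hx]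
  exact W.comps_apply_mem _ _

theorem exists_d_comp_comp_d_eq (V : DGModule.{u, v} k) :
    ∃ s : V →ₗ[k] V, (∀ n, ∀ x ∈ V.deg n, s x ∈ V.deg (n - 1)) ∧ V.d ∘ₗ s ∘ₗ V.d = V.d := by
  obtain ⟨s, hs⟩ := exists_linearMap_comp_comp_eq V.d
  refine ⟨homComponent (-1) s, fun n x hx => homComponent_mem (-1) s hx,
    V.hom_ext fun n x hx => ?_⟩
  have hsd : V.d (s (V.d x)) = V.d x := LinearMap.congr_fun hs x
  have hdx := V.d_mem hx
  rw [LinearMap.comp_apply, LinearMap.comp_apply, homComponent_of_mem _ _ hdx,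
    add_neg_cancel_right, ← comps_d, hsd, V.comps_of_mem hdx, Finsupp.single_eq_same]

theorem exists_contraction_of_exact (V : DGModule.{u, v} k) (hV : Function.Exact V.d V.d) :
    ∃ s : V →ₗ[k] V, (∀ n, ∀ x ∈ V.deg n, s x ∈ V.deg (n - 1)) ∧
      V.d ∘ₗ s + s ∘ₗ V.d = LinearMap.id := by
  obtain ⟨s, hs_mem, hs⟩ := V.exists_d_comp_comp_d_eq
  have hdsd : ∀ x, V.d (s (V.d x)) = V.d x := LinearMap.congr_fun hs
  have hdd : ∀ x, V.d (V.d x) = 0 := LinearMap.congr_fun V.d_comp_d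
  refine ⟨s ∘ₗ (LinearMap.id - s ∘ₗ V.d), fun n x hx => ?_, LinearMap.ext fun x => ?_⟩
  · refine hs_mem n _ (Submodule.sub_mem _ hx ?_)
    simpa only [add_sub_cancel_right, LinearMap.comp_apply] using hs_mem _ _ (V.d_mem hx)
  · obtain ⟨y, hy⟩ := (hV (x - s (V.d x))).1 (by rw [map_sub, hdsd, sub_self])
    have hdsy := hdsd y
    rw [hy] at hdsy
    simp only [LinearMap.add_apply, LinearMap.comp_apply, LinearMap.sub_apply, LinearMap.id_apply,
      hdsy, hdd, map_zero, sub_zero, sub_add_cancel]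

theorem parity_pow_mul_self (V : DGModule.{u, v} k) (n : ℕ) : V.parity ^ n * V.parity ^ n = 1 := by
  have h : V.parity * V.parity = 1 := V.parity_comp_parity
  rw [← pow_add, ← two_mul, pow_mul, sq, h, one_pow]

section Total

variable {X : ℕ → DGModule.{u, v} k}

theorem component_mem {p : ℤ} {x : ⨁ n, X n} (hx : x ∈ totalDeg X p) (j : ℕ) :
    component k ℕ (fun n => X n) j x ∈ (X j).deg (p - j) := by
  have h : totalDeg X p ≤ ((X j).deg (p - j)).comap (component k ℕ (fun n => X n) j) := by
    refine totalDeg_le X fun n q hq x hx => ?_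
    rw [Submodule.mem_comap]
    obtain rfl | hne := eq_or_ne j n
    · rwa [component.lof_self, show p - j = q by omega]
    · rw [component.of, dif_neg hne.symm]
      exact Submodule.zero_mem _
  exact h hx

theorem totalDeg_eq_bot {n₀ p : ℤ} (hX : ∀ j, ∀ n < n₀, (X j).deg n = ⊥) (hp : p < n₀) :
    totalDeg X p = ⊥ :=
  eq_bot_iff.2 <| totalDeg_le X fun j q hq x hx => by
    rw [hX j q (by omega), Submodule.mem_bot] at hx
    simp [hx]

variable (X) in
/-- The decreasing filtration of `⨁ n, X_n` by the submodules `⨁ n ≥ j, X_n`. -/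
def totalFilt (j : ℕ) : Submodule k (⨁ n, X n) :=
  ⨅ n : Set.Iio j, LinearMap.ker (component k ℕ (fun n => X n) n)

theorem mem_totalFilt {j : ℕ} {x : ⨁ n, X n} :
    x ∈ totalFilt X j ↔ ∀ n < j, component k ℕ (fun n => X n) n x = 0 := by
  simp [totalFilt]

theorem totalFilt_zero : totalFilt X 0 = ⊤ :=
  eq_top_iff.2 fun _ _ => mem_totalFilt.2 fun _ hn => absurd hn (Nat.not_lt_zero _)

theorem mem_totalFilt_succ {j : ℕ} {x : ⨁ n, X n} :
    x ∈ totalFilt X (j + 1) ↔ x ∈ totalFilt X j ∧ component k ℕ (fun n => X n) j x = 0 := by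
  simp only [mem_totalFilt, Nat.lt_succ_iff_lt_or_eq, or_imp, forall_and, forall_eq]

theorem lof_mem_totalFilt (j : ℕ) (x : X j) :
    lof k ℕ (fun n => X n) j x ∈ totalFilt X j :=
  mem_totalFilt.2 fun n hn => by rw [component.of, dif_neg hn.ne']

theorem disjoint_totalFilt_totalDeg {n₀ p : ℤ} {j : ℕ} (hX : ∀ i, ∀ n < n₀, (X i).deg n = ⊥)
    (hj : p - j < n₀) : Disjoint (totalFilt X j) (totalDeg X p) := by
  refine Submodule.disjoint_def.2 fun x hxF hxp => ext_component k fun n => ?_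
  rw [map_zero]
  obtain hn | hn := lt_or_ge n j
  · exact mem_totalFilt.1 hxF n hn
  · have hmem := component_mem hxp n
    rwa [hX n _ (by omega), Submodule.mem_bot] at hmem

variable {β : ∀ n, X n →ₗ[k] X (n + 1)}

theorem totalD_lof (n : ℕ) (x : X n) :
    totalD X β (lof k ℕ (fun n => X n) n x) =
      (-1 : k) ^ n • lof k ℕ (fun n => X n) n ((X n).d x) +
        lof k ℕ (fun n => X n) (n + 1) (β n x) := by
  rw [totalD, toModule_lof]
  rfl

theorem component_zero_totalD (x : ⨁ n, X n) :
    component k ℕ (fun n => X n) 0 (totalD X β x) =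
      (X 0).d (component k ℕ (fun n => X n) 0 x) := by
  induction x using DirectSum.induction_on with
  | zero => simp only [map_zero]
  | add x y hx hy => simp only [map_add, hx, hy]
  | of n x =>
    rw [← lof_eq_of k, totalD_lof, map_add, map_smul, component.of, component.of, component.of,
      dif_neg n.succ_ne_zero, add_zero]
    split_ifs with h
    · subst h; simp only [pow_zero, one_smul]
    · simp only [smul_zero, map_zero]

theorem component_succ_totalD (j : ℕ) (x : ⨁ n, X n) :
    component k ℕ (fun n => X n) (j + 1) (totalD X β x) =
      (-1 : k) ^ (j + 1) • (X (j + 1)).d (component k ℕ (fun n => X n) (j + 1) x) +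
        β j (component k ℕ (fun n => X n) j x) := by
  induction x using DirectSum.induction_on with
  | zero => simp only [map_zero, smul_zero, add_zero]
  | add x y hx hy => simp only [map_add, hx, hy, smul_add]; abel
  | of n x =>
    rw [← lof_eq_of k, totalD_lof, map_add, map_smul]
    simp only [component.of]
    obtain rfl | hn := eq_or_ne n (j + 1)
    · simp
    · obtain rfl | hnj := eq_or_ne n j
      · simp
      · simp [hn, hnj]

theorem component_totalD {j : ℕ} {x : ⨁ n, X n} (hx : x ∈ totalFilt X j) :
    component k ℕ (fun n => X n) j (totalD X β x) =
      (-1 : k) ^ j • (X j).d (component k ℕ (fun n => X n) j x) := by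
  cases j with
  | zero => rw [component_zero_totalD, pow_zero, one_smul]
  | succ j =>
    rw [component_succ_totalD, mem_totalFilt.1 hx j j.lt_succ_self, map_zero, add_zero]

theorem totalD_mem_totalFilt {j : ℕ} {x : ⨁ n, X n} (hx : x ∈ totalFilt X j) :
    totalD X β x ∈ totalFilt X j := by
  refine mem_totalFilt.2 fun n hn => ?_
  have hxn : x ∈ totalFilt X n := mem_totalFilt.2 fun i hi => mem_totalFilt.1 hx i (hi.trans hn)
  rw [component_totalD hxn, mem_totalFilt.1 hx n hn, map_zero, smul_zero]

end Total

theorem tensorDeg_eq_bot {V W : DGModule.{u, v} k} {a b n : ℤ} (hV : ∀ p < a, V.deg p = ⊥)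
    (hW : ∀ q < b, W.deg q = ⊥) (hn : n < a + b) : tensorDeg V W n = ⊥ :=
  eq_bot_iff.2 <| tensorDeg_le V W fun p q hpq x hx y hy => by
    rcases lt_or_ge p a with hp | hp
    · rw [hV p hp, Submodule.mem_bot] at hx
      simp [hx]
    · rw [hW q (by omega), Submodule.mem_bot] at hy
      simp [hy]

theorem tensorD_comp_map_add (P : DGModule.{u, v} k) {V W : DGModule.{u, v} k} (q : ℕ)
    (f : V →ₗ[k] W) :
    tensorD P W ∘ₗ TensorProduct.map (P.parity ^ (q + 1)) f +
        (-1 : k) ^ q • (TensorProduct.map (P.parity ^ (q + 1)) f ∘ₗ tensorD P V) =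
      TensorProduct.map (P.parity ^ q) (W.d ∘ₗ f + (-1 : k) ^ q • (f ∘ₗ V.d)) := by
  refine TensorProduct.ext' fun c x => ?_
  have hσ : P.parity * P.parity = 1 := P.parity_comp_parity
  have hσl : P.parity ((P.parity ^ (q + 1)) c) = (P.parity ^ q) c := by
    rw [pow_succ', ← Module.End.mul_apply, ← mul_assoc, hσ, one_mul]
  have hσr : (P.parity ^ (q + 1)) (P.parity c) = (P.parity ^ q) c := by
    rw [← Module.End.mul_apply, pow_succ, mul_assoc, hσ, mul_one]
  simp only [tensorD, LinearMap.add_apply, LinearMap.comp_apply, LinearMap.smul_apply,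
    TensorProduct.map_tmul, LinearMap.id_apply, map_add, hσl, hσr,
    DGComodule.parity_pow_d, ← TensorProduct.smul_tmul', smul_add, smul_smul,
    TensorProduct.tmul_add, TensorProduct.tmul_smul]
  rw [pow_succ (-1 : k), ← mul_assoc, neg_one_pow_mul_self, one_mul, neg_one_smul]
  abel

end DGModule

open DGModule

namespace DGCoalgebra

variable (C : DGCoalgebra.{u, v} k)

theorem comulTensor_comp_map_parity {V W : Type v} [AddCommGroup V] [Module k V] [AddCommGroup W]
    [Module k W] (q : ℕ) (f : V →ₗ[k] W) :
    C.comulTensor W ∘ₗ TensorProduct.map (C.parity ^ q) f =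
      TensorProduct.map (C.parity ^ q) (TensorProduct.map (C.parity ^ q) f) ∘ₗ
        C.comulTensor V := by
  refine TensorProduct.ext' fun c w => ?_
  simp only [comulTensor, LinearMap.comp_apply, TensorProduct.map_tmul, LinearMap.id_apply,
    LinearEquiv.coe_coe, DGComodule.comul_parity_pow]
  generalize Coalgebra.comul (R := k) c = z
  induction z with
  | zero => simp
  | add x y hx hy => simp only [TensorProduct.add_tmul, map_add, hx, hy]
  | tmul x y => simp

/-- `ε ⊗ id : C ⊗ V → V`. -/
def counitTensor (V : Type v) [AddCommGroup V] [Module k V] : C.carrier ⊗[k] V →ₗ[k] V :=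
  (TensorProduct.lid k V).toLinearMap ∘ₗ TensorProduct.map Coalgebra.counit LinearMap.id

variable {C}

theorem counitTensor_tmul {V : Type v} [AddCommGroup V] [Module k V] (c : C.carrier) (x : V) :
    C.counitTensor V (c ⊗ₜ x) = Coalgebra.counit (R := k) c • x :=
  rfl

theorem counitTensor_comp_map_parity {V W : Type v} [AddCommGroup V] [Module k V]
    [AddCommGroup W] [Module k W] (q : ℕ) (f : V →ₗ[k] W) :
    C.counitTensor W ∘ₗ TensorProduct.map (C.parity ^ q) f = f ∘ₗ C.counitTensor V :=
  TensorProduct.ext' fun c x => by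
    simp only [LinearMap.comp_apply, TensorProduct.map_tmul, counitTensor_tmul, map_smul,
      DGComodule.counit_parity_pow]

theorem counitTensor_comp_tensorD (V : DGModule.{u, v} k) :
    C.counitTensor V ∘ₗ tensorD C.toDGModule V = V.d ∘ₗ C.counitTensor V :=
  TensorProduct.ext' fun c x => by
    have hd : Coalgebra.counit (R := k) (C.d c) = 0 := LinearMap.congr_fun C.counit_comp_d c
    have hσ : Coalgebra.counit (R := k) (C.parity c) = Coalgebra.counit (R := k) c :=
      LinearMap.congr_fun C.counit_comp_parity c
    simp only [tensorD, LinearMap.comp_apply, LinearMap.add_apply, TensorProduct.map_tmul,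
      map_add, counitTensor_tmul, hd, hσ, zero_smul, zero_add, map_smul]

theorem counitTensor_mem (V : DGModule.{u, v} k) {n : ℤ} {z : C.carrier ⊗[k] V}
    (hz : z ∈ tensorDeg C.toDGModule V n) : C.counitTensor V z ∈ V.deg n := by
  have h : tensorDeg C.toDGModule V n ≤ (V.deg n).comap (C.counitTensor V) := by
    refine tensorDeg_le _ _ fun p q hpq c hc x hx => ?_
    rw [Submodule.mem_comap, counitTensor_tmul]
    obtain rfl | hp := eq_or_ne p 0
    · obtain rfl : q = n := by omega
      exact Submodule.smul_mem _ _ hx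
    · rw [C.counit_of_mem hc hp, zero_smul]
      exact Submodule.zero_mem _
  exact h hz

theorem map_counitTensor_comp_comulTensor (V : Type v) [AddCommGroup V] [Module k V] :
    TensorProduct.map LinearMap.id (C.counitTensor V) ∘ₗ C.comulTensor V = LinearMap.id := by
  refine TensorProduct.ext' fun c x => ?_
  have h : TensorProduct.map LinearMap.id (C.counitTensor V) ∘ₗ
      (TensorProduct.assoc k C.carrier C.carrier V).toLinearMap =
        TensorProduct.map ((TensorProduct.rid k C.carrier).toLinearMap ∘ₗ
          LinearMap.lTensor C.carrier Coalgebra.counit) LinearMap.id :=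
    TensorProduct.ext_threefold fun a b y => by simp [counitTensor_tmul, TensorProduct.smul_tmul]
  have hc := congrArg (TensorProduct.rid k C.carrier) (Coalgebra.lTensor_counit_comul (R := k) c)
  rw [comulTensor, ← LinearMap.comp_assoc, h, LinearMap.comp_apply, TensorProduct.map_tmul,
    TensorProduct.map_tmul, LinearMap.comp_apply, LinearEquiv.coe_coe, hc]
  simp

theorem counitTensor_comp_comulTensor (V : Type v) [AddCommGroup V] [Module k V] :
    C.counitTensor (C.carrier ⊗[k] V) ∘ₗ C.comulTensor V = LinearMap.id := by
  refine TensorProduct.ext' fun c x => ?_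
  have h : C.counitTensor (C.carrier ⊗[k] V) ∘ₗ
      (TensorProduct.assoc k C.carrier C.carrier V).toLinearMap =
        TensorProduct.map ((TensorProduct.lid k C.carrier).toLinearMap ∘ₗ
          LinearMap.rTensor C.carrier Coalgebra.counit) LinearMap.id :=
    TensorProduct.ext_threefold fun a b y => by simp [counitTensor_tmul, TensorProduct.smul_tmul']
  have hc := congrArg (TensorProduct.lid k C.carrier) (Coalgebra.rTensor_counit_comul (R := k) c)
  rw [comulTensor, ← LinearMap.comp_assoc, h, LinearMap.comp_apply, TensorProduct.map_tmul,
    TensorProduct.map_tmul, LinearMap.comp_apply, LinearEquiv.coe_coe, hc]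
  simp

end DGCoalgebra

variable {C : DGCoalgebra.{u, v} k}

/-- Colinearity with the Koszul sign of a map of degree `q`, for arbitrary structure maps
`α : A → C ⊗ A` and `β : B → C ⊗ B`: `β (f a) = ∑ (-1)^{q |c|} c ⊗ f a'` if `α a = ∑ c ⊗ a'`.
Only the parity of `q` matters. -/
def IsKoszulColinear {A B : Type v} [AddCommGroup A] [Module k A] [AddCommGroup B] [Module k B]
    (q : ℕ) (α : A →ₗ[k] C.carrier ⊗[k] A) (β : B →ₗ[k] C.carrier ⊗[k] B) (f : A →ₗ[k] B) : Prop :=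
  β ∘ₗ f = TensorProduct.map (C.parity ^ q) f ∘ₗ α

section IsKoszulColinear

variable {A B E : Type v} [AddCommGroup A] [Module k A] [AddCommGroup B] [Module k B]
  [AddCommGroup E] [Module k E] {q r : ℕ} {α : A →ₗ[k] C.carrier ⊗[k] A}
  {β : B →ₗ[k] C.carrier ⊗[k] B} {γ : E →ₗ[k] C.carrier ⊗[k] E} {f g : A →ₗ[k] B}

theorem isKoszulColinear_one_iff :
    IsKoszulColinear 1 α β f ↔ β ∘ₗ f = TensorProduct.map C.parity f ∘ₗ α := by
  rw [IsKoszulColinear, pow_one]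

theorem isKoszulColinear_add_two_mul_iff (j : ℕ) :
    IsKoszulColinear (q + 2 * j) α β f ↔ IsKoszulColinear q α β f := by
  have hσ : C.parity ^ (2 * j) = 1 := by rw [two_mul, pow_add, parity_pow_mul_self]
  rw [IsKoszulColinear, pow_add, hσ, mul_one, IsKoszulColinear]

namespace IsKoszulColinear

theorem apply (hf : IsKoszulColinear q α β f) (x : A) :
    β (f x) = TensorProduct.map (C.parity ^ q) f (α x) :=
  LinearMap.congr_fun hf x

theorem zero : IsKoszulColinear q α β 0 := by
  rw [IsKoszulColinear, LinearMap.comp_zero, TensorProduct.map_zero_right, LinearMap.zero_comp]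

theorem add (hf : IsKoszulColinear q α β f) (hg : IsKoszulColinear q α β g) :
    IsKoszulColinear q α β (f + g) := by
  rw [IsKoszulColinear, LinearMap.comp_add, hf, hg, TensorProduct.map_add_right,
    LinearMap.add_comp]

theorem smul (c : k) (hf : IsKoszulColinear q α β f) : IsKoszulColinear q α β (c • f) := by
  rw [IsKoszulColinear, LinearMap.comp_smul, hf, TensorProduct.map_smul_right,
    LinearMap.smul_comp]

theorem comp {g : B →ₗ[k] E} (hg : IsKoszulColinear r β γ g) (hf : IsKoszulColinear q α β f) :
    IsKoszulColinear (r + q) α γ (g ∘ₗ f) := by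
  rw [IsKoszulColinear, ← LinearMap.comp_assoc, hg, LinearMap.comp_assoc, hf,
    ← LinearMap.comp_assoc, ← TensorProduct.map_comp, ← Module.End.mul_eq_comp, ← pow_add]

theorem coassoc_comp (hf : IsKoszulColinear q α β f)
    (hα : C.comulTensor A ∘ₗ α = TensorProduct.map LinearMap.id α ∘ₗ α) :
    (C.comulTensor B ∘ₗ β) ∘ₗ f = (TensorProduct.map LinearMap.id β ∘ₗ β) ∘ₗ f := by
  rw [LinearMap.comp_assoc, LinearMap.comp_assoc, hf, ← LinearMap.comp_assoc,
    C.comulTensor_comp_map_parity, LinearMap.comp_assoc, hα, ← LinearMap.comp_assoc,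
    ← LinearMap.comp_assoc, ← TensorProduct.map_comp, ← TensorProduct.map_comp, hf,
    LinearMap.comp_id, LinearMap.id_comp]

theorem counitTensor_comp (hf : IsKoszulColinear q α β f)
    (hα : C.counitTensor A ∘ₗ α = LinearMap.id) :
    (C.counitTensor B ∘ₗ β) ∘ₗ f = f := by
  rw [LinearMap.comp_assoc, hf, ← LinearMap.comp_assoc,
    DGCoalgebra.counitTensor_comp_map_parity, LinearMap.comp_assoc, hα, LinearMap.comp_id]

end IsKoszulColinear

end IsKoszulColinear

section Differential

variable {A B : DGModule.{u, v} k} {q : ℕ} {α : A →ₗ[k] C.carrier ⊗[k] A}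
  {β : B →ₗ[k] C.carrier ⊗[k] B} {f : A →ₗ[k] B}

theorem tensorD_comp_map_parity_comp (hα : α ∘ₗ A.d = tensorD C.toDGModule A ∘ₗ α) :
    tensorD C.toDGModule B ∘ₗ TensorProduct.map (C.parity ^ (q + 1)) f ∘ₗ α +
        (-1 : k) ^ q • ((TensorProduct.map (C.parity ^ (q + 1)) f ∘ₗ α) ∘ₗ A.d) =
      TensorProduct.map (C.parity ^ q) (B.d ∘ₗ f + (-1 : k) ^ q • (f ∘ₗ A.d)) ∘ₗ α := by
  rw [← tensorD_comp_map_add, LinearMap.add_comp, LinearMap.smul_comp, LinearMap.comp_assoc,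
    LinearMap.comp_assoc, LinearMap.comp_assoc, hα]

namespace IsKoszulColinear

theorem boundary (hα : α ∘ₗ A.d = tensorD C.toDGModule A ∘ₗ α)
    (hβ : β ∘ₗ B.d = tensorD C.toDGModule B ∘ₗ β) (hf : IsKoszulColinear (q + 1) α β f) :
    IsKoszulColinear q α β (B.d ∘ₗ f + (-1 : k) ^ q • (f ∘ₗ A.d)) := by
  rw [IsKoszulColinear, ← tensorD_comp_map_parity_comp hα, ← hf, LinearMap.comp_add,
    LinearMap.comp_smul, ← LinearMap.comp_assoc, hβ, LinearMap.comp_assoc, LinearMap.comp_assoc]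

theorem coact_comp_d_comp (hα : α ∘ₗ A.d = tensorD C.toDGModule A ∘ₗ α)
    (hf : IsKoszulColinear (q + 1) α β f)
    (hdf : IsKoszulColinear q α β (B.d ∘ₗ f + (-1 : k) ^ q • (f ∘ₗ A.d))) :
    (β ∘ₗ B.d) ∘ₗ f = (tensorD C.toDGModule B ∘ₗ β) ∘ₗ f := by
  rw [IsKoszulColinear, ← tensorD_comp_map_parity_comp hα, ← hf, LinearMap.comp_add,
    LinearMap.comp_smul] at hdf
  exact add_right_cancel hdf

end IsKoszulColinear

end Differential

section GradedLimit

variable {ι : Type*} {l : Filter ι}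

theorem IsKoszulColinear.of_eventually_eq
    {A B : Type v} [AddCommGroup A] [Module k A] [AddCommGroup B] [Module k B] {q : ℕ}
    {α : A →ₗ[k] C.carrier ⊗[k] A} {β : B →ₗ[k] C.carrier ⊗[k] B} [NeBot l] {s : ι → A →ₗ[k] B}
    {t : A →ₗ[k] B} (ht : ∀ x, ∀ᶠ i in l, s i x = t x)
    (hs : ∀ i, IsKoszulColinear q α β (s i)) : IsKoszulColinear q α β t :=
  LinearMap.ext fun x => by
    obtain ⟨i, hx, hαx⟩ :=
      ((ht x).and (eventually_map_apply_eq ht (C.parity ^ q) (α x))).exists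
    rw [LinearMap.comp_apply, LinearMap.comp_apply, ← hx, ← hαx, (hs i).apply]

theorem DGModule.eventually_apply_eq_zero {A B : DGModule.{u, v} k}
    {F : ι → Submodule k B} (hF : ∀ n, ∀ᶠ i in l, Disjoint (F i) (B.deg n)) {r : ℤ}
    {g : ι → A →ₗ[k] B} (hg : ∀ i n, ∀ x ∈ A.deg n, g i x ∈ B.deg (n + r))
    (hgF : ∀ i, LinearMap.range (g i) ≤ F i) (x : A) : ∀ᶠ i in l, g i x = 0 := by
  have hx : x ∈ ⨆ n, A.deg n := A.isInternal.submodule_iSup_eq_top ▸ Submodule.mem_top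
  induction hx using Submodule.iSup_induction' with
  | mem n x hx =>
    filter_upwards [hF (n + r)] with i hi
    exact Submodule.disjoint_def.1 hi _ (hgF i (LinearMap.mem_range_self _ x)) (hg i n x hx)
  | zero => simp
  | add x y _ _ hx hy =>
    filter_upwards [hx, hy] with i hx hy using by rw [map_add, hx, hy, add_zero]

end GradedLimit

section HomComplex

variable (A X : DGComodule.{u, v} C)

/-- The linear maps underlying the morphisms `A ⟶ X`, that is, the cycles of degree `0` in the
complex of graded colinear maps. -/
def chainMaps : Submodule k (A.carrier →ₗ[k] X.carrier) where
  carrier := {f | (∀ n, ∀ x ∈ A.deg n, f x ∈ X.deg n) ∧ f ∘ₗ A.d = X.d ∘ₗ f ∧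
    IsKoszulColinear 0 A.coact X.coact f}
  zero_mem' := ⟨fun n _ _ => (X.deg n).zero_mem,
    by rw [LinearMap.zero_comp, LinearMap.comp_zero], .zero⟩
  add_mem' hf hg := ⟨fun n x hx => (X.deg n).add_mem (hf.1 n x hx) (hg.1 n x hx), by
    rw [LinearMap.add_comp, LinearMap.comp_add, hf.2.1, hg.2.1], hf.2.2.add hg.2.2⟩
  smul_mem' c _ hf := ⟨fun n x hx => (X.deg n).smul_mem c (hf.1 n x hx), by
    rw [LinearMap.smul_comp, LinearMap.comp_smul, hf.2.1], hf.2.2.smul c⟩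

/-- The graded colinear maps `A → X` of degree `-1`. -/
def homotopies : Submodule k (A.carrier →ₗ[k] X.carrier) where
  carrier := {h | (∀ n, ∀ x ∈ A.deg n, h x ∈ X.deg (n - 1)) ∧
    IsKoszulColinear 1 A.coact X.coact h}
  zero_mem' := ⟨fun _ _ _ => (X.deg _).zero_mem, .zero⟩
  add_mem' hf hg := ⟨fun n x hx => (X.deg _).add_mem (hf.1 n x hx) (hg.1 n x hx), hf.2.add hg.2⟩
  smul_mem' c _ hf := ⟨fun n x hx => (X.deg _).smul_mem c (hf.1 n x hx), hf.2.smul c⟩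

/-- The differential `h ↦ h d + d h` on maps of degree `-1`. -/
def homotopyBoundary :
    (A.carrier →ₗ[k] X.carrier) →ₗ[k] (A.carrier →ₗ[k] X.carrier) :=
  LinearMap.lcomp k X.carrier A.d + LinearMap.llcomp k A.carrier X.carrier X.carrier X.d

/-- The null-homotopic maps `A → X`. -/
def nullHomotopic : Submodule k (A.carrier →ₗ[k] X.carrier) :=
  (homotopies A X).map (homotopyBoundary A X)

variable {A X}

theorem homotopyBoundary_apply (h : A.carrier →ₗ[k] X.carrier) :
    homotopyBoundary A X h = h ∘ₗ A.d + X.d ∘ₗ h :=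
  rfl

theorem mem_nullHomotopic {f : A.carrier →ₗ[k] X.carrier} :
    f ∈ nullHomotopic A X ↔ ∃ h ∈ homotopies A X, f = h ∘ₗ A.d + X.d ∘ₗ h := by
  simp only [nullHomotopic, Submodule.mem_map, homotopyBoundary_apply, eq_comm]

theorem homotopyBoundary_mem_chainMaps {h : A.carrier →ₗ[k] X.carrier}
    (hh : h ∈ homotopies A X) : homotopyBoundary A X h ∈ chainMaps A X := by
  rw [homotopyBoundary_apply]
  refine ⟨fun n x hx => ?_, ?_, ?_⟩
  · have hdx := hh.1 _ _ (A.d_mem hx)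
    have hhx := X.d_mem (hh.1 n x hx)
    rw [add_sub_cancel_right] at hdx
    rw [sub_add_cancel] at hhx
    exact Submodule.add_mem _ hdx hhx
  · rw [LinearMap.add_comp, LinearMap.comp_add, LinearMap.comp_assoc, A.d_comp_d,
      ← LinearMap.comp_assoc h, X.d_comp_d, LinearMap.comp_zero, LinearMap.zero_comp, zero_add,
      add_zero, LinearMap.comp_assoc]
  · have := IsKoszulColinear.boundary (q := 0) A.coact_comp_d X.coact_comp_d hh.2
    rwa [pow_zero, one_smul, add_comm] at this

theorem lin_mem_chainMaps (f : A ⟶ X) : DGPrecomodule.Hom.lin f ∈ chainMaps A X :=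
  ⟨fun _ _ hx => DGPrecomodule.Hom.map_mem f hx, DGPrecomodule.Hom.comp_d f,
    DGPrecomodule.Hom.colinear f⟩

/-- The morphism with a given underlying linear map. -/
def homOfMemChainMaps {f : A.carrier →ₗ[k] X.carrier} (hf : f ∈ chainMaps A X) : A ⟶ X where
  lin := f
  map_mem hx := hf.1 _ _ hx
  comp_d := hf.2.1
  colinear := hf.2.2

theorem homotopic_iff {f g : A ⟶ X} : Homotopic C f g ↔
    DGPrecomodule.Hom.lin f - DGPrecomodule.Hom.lin g ∈ nullHomotopic A X := by
  simp only [Homotopic, mem_nullHomotopic, homotopies, isKoszulColinear_one_iff,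
    Submodule.mem_mk, AddSubmonoid.mem_mk, AddSubsemigroup.mem_mk, Set.mem_ofPred_eq, and_assoc]

end HomComplex

section Filtration

variable {A X : DGComodule.{u, v} C} {F : ℕ → Submodule k X.carrier}

theorem exists_homotopy_seq_of_filtration (hF₀ : F 0 = ⊤)
    (hstep : ∀ j, ∀ f ∈ chainMaps A X, LinearMap.range f ≤ F j → ∃ h ∈ homotopies A X,
      LinearMap.range h ≤ F j ∧ LinearMap.range (f - homotopyBoundary A X h) ≤ F (j + 1))
    {f : A.carrier →ₗ[k] X.carrier} (hf : f ∈ chainMaps A X) :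
    ∃ s : ℕ → A.carrier →ₗ[k] X.carrier, (∀ j, s j ∈ homotopies A X) ∧
      (∀ j, LinearMap.range (f - homotopyBoundary A X (s j)) ≤ F j) ∧
        ∀ j, LinearMap.range (s (j + 1) - s j) ≤ F j := by
  let Approx (j : ℕ) :=
    {s // s ∈ homotopies A X ∧ LinearMap.range (f - homotopyBoundary A X s) ≤ F j}
  have hnext (j : ℕ) (s : Approx j) :
      ∃ s' : Approx (j + 1), LinearMap.range (s'.1 - s.1) ≤ F j := by
    obtain ⟨h, hh, hhF, hbdry⟩ := hstep j _
      (Submodule.sub_mem _ hf (homotopyBoundary_mem_chainMaps s.2.1)) s.2.2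
    refine ⟨⟨s.1 + h, Submodule.add_mem _ s.2.1 hh, ?_⟩, ?_⟩
    · rwa [map_add, ← sub_sub]
    · rwa [add_sub_cancel_left]
  choose next hnext using hnext
  let s : ∀ j, Approx j := Nat.rec ⟨0, Submodule.zero_mem _, hF₀ ▸ le_top⟩ next
  exact ⟨fun j => (s j).1, fun j => (s j).2.1, fun j => (s j).2.2, fun j => hnext j (s j)⟩

theorem chainMaps_le_nullHomotopic_of_filtration (hF₀ : F 0 = ⊤)
    (hF : ∀ n, ∀ᶠ j in atTop, Disjoint (F j) (X.deg n))
    (hstep : ∀ j, ∀ f ∈ chainMaps A X, LinearMap.range f ≤ F j → ∃ h ∈ homotopies A X,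
      LinearMap.range h ≤ F j ∧ LinearMap.range (f - homotopyBoundary A X h) ≤ F (j + 1)) :
    chainMaps A X ≤ nullHomotopic A X := by
  intro f hf
  obtain ⟨s, hs, hs_bdry, hs_succ⟩ := exists_homotopy_seq_of_filtration hF₀ hstep hf
  have hs_const : ∀ x, EventuallyConst (fun j => s j x) atTop := fun x => by
    have hzero := DGModule.eventually_apply_eq_zero hF (r := -1)
      (fun j => ((homotopies A X).sub_mem (hs (j + 1)) (hs j)).1) hs_succ x
    obtain ⟨J, hJ⟩ := eventually_atTop.1 hzero
    exact eventuallyConst_atTop_nat.2 ⟨J, fun j hj => sub_eq_zero.1 (hJ j hj)⟩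
  obtain ⟨t, ht⟩ := exists_linearMap_eventually_eq hs_const
  refine mem_nullHomotopic.2 ⟨t, ⟨fun n x hx => ?_, .of_eventually_eq ht fun j => (hs j).2⟩,
    LinearMap.ext fun x => ?_⟩
  · obtain ⟨j, hj⟩ := (ht x).exists
    exact hj ▸ (hs j).1 n x hx
  · have hzero := DGModule.eventually_apply_eq_zero hF (r := 0)
      (fun j n x hx => by
        rw [add_zero]
        exact ((chainMaps A X).sub_mem hf (homotopyBoundary_mem_chainMaps (hs j))).1 n x hx)
      hs_bdry x
    obtain ⟨j, hbdry, hx, hdx⟩ := (hzero.and ((ht x).and (ht (A.d x)))).exists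
    rw [LinearMap.sub_apply, sub_eq_zero] at hbdry
    rw [hbdry, homotopyBoundary_apply]
    simp only [LinearMap.add_apply, LinearMap.comp_apply, hx, hdx]

end Filtration

section Cofree

variable {A V : Type v} [AddCommGroup A] [Module k A] [AddCommGroup V] [Module k V] {q : ℕ}
  {α : A →ₗ[k] C.carrier ⊗[k] A}

/-- The map `A → C ⊗ V` of degree parity `q` that is colinear with the Koszul sign and
corresponds to the linear map `u : A → V` by the cofreeness of `C ⊗ V`. -/
def cofreeLift (q : ℕ) (α : A →ₗ[k] C.carrier ⊗[k] A) (u : A →ₗ[k] V) : A →ₗ[k] C.carrier ⊗[k] V :=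
  TensorProduct.map (C.parity ^ q) u ∘ₗ α

theorem isKoszulColinear_cofreeLift
    (hα : C.comulTensor A ∘ₗ α = TensorProduct.map LinearMap.id α ∘ₗ α) (u : A →ₗ[k] V) :
    IsKoszulColinear q α (C.comulTensor V) (cofreeLift q α u) := by
  rw [IsKoszulColinear, cofreeLift, ← LinearMap.comp_assoc, C.comulTensor_comp_map_parity,
    LinearMap.comp_assoc, hα, ← LinearMap.comp_assoc, ← TensorProduct.map_comp, LinearMap.comp_id]

theorem cofreeLift_counitTensor_comp {f : A →ₗ[k] C.carrier ⊗[k] V}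
    (hf : IsKoszulColinear q α (C.comulTensor V) f) :
    cofreeLift q α (C.counitTensor V ∘ₗ f) = f := by
  rw [cofreeLift, ← LinearMap.id_comp (C.parity ^ q), TensorProduct.map_comp,
    LinearMap.comp_assoc, ← hf, ← LinearMap.comp_assoc,
    DGCoalgebra.map_counitTensor_comp_comulTensor, LinearMap.id_comp]

theorem cofreeLift_smul (c : k) (u : A →ₗ[k] V) :
    cofreeLift q α (c • u) = c • cofreeLift q α u := by
  rw [cofreeLift, TensorProduct.map_smul_right, LinearMap.smul_comp, cofreeLift]

end Cofree

section ExactComodule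

variable {A : DGComodule.{u, v} C} {V : DGModule.{u, v} k}

theorem cofreeLift_mem {q : ℕ} {r : ℤ} {u : A.carrier →ₗ[k] V}
    (hu : ∀ n, ∀ x ∈ A.deg n, u x ∈ V.deg (n + r)) {n : ℤ} {x : A.carrier} (hx : x ∈ A.deg n) :
    cofreeLift q A.coact u x ∈ tensorDeg C.toDGModule V (n + r) :=
  map_mem_tensorDeg (a := 0) (b := r)
    (fun m c hc => by rw [add_zero]; exact DGComodule.parity_pow_mem C.toDGModule q hc) hu
    (by omega) (A.coact_mem hx)

theorem exists_homotopy_of_exact (hA : Function.Exact A.d A.d) {q : ℕ}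
    {f : A.carrier →ₗ[k] C.carrier ⊗[k] V} (hf : IsKoszulColinear q A.coact (C.comulTensor V) f)
    (hf_mem : ∀ n, ∀ x ∈ A.deg n, f x ∈ tensorDeg C.toDGModule V (n - q))
    (hf_d : f ∘ₗ A.d = (-1 : k) ^ q • tensorD C.toDGModule V ∘ₗ f) :
    ∃ h : A.carrier →ₗ[k] C.carrier ⊗[k] V,
      (∀ n, ∀ x ∈ A.deg n, h x ∈ tensorDeg C.toDGModule V (n - 1 - q)) ∧
      IsKoszulColinear (q + 1) A.coact (C.comulTensor V) h ∧
      (-1 : k) ^ q • tensorD C.toDGModule V ∘ₗ h + h ∘ₗ A.d = f := by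
  obtain ⟨s, hs_mem, hs⟩ := A.exists_contraction_of_exact hA
  set g := C.counitTensor V ∘ₗ f with hg
  have hg_d : V.d ∘ₗ g = (-1 : k) ^ q • (g ∘ₗ A.d) := by
    rw [hg, LinearMap.comp_assoc, hf_d, LinearMap.comp_smul, smul_smul, neg_one_pow_mul_self,
      one_smul, ← LinearMap.comp_assoc, ← LinearMap.comp_assoc,
      DGCoalgebra.counitTensor_comp_tensorD]
  have hgs_d : V.d ∘ₗ (g ∘ₗ s) + (-1 : k) ^ q • ((g ∘ₗ s) ∘ₗ A.d) = (-1 : k) ^ q • g := by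
    rw [← LinearMap.comp_assoc, hg_d, LinearMap.smul_comp, LinearMap.comp_assoc s A.d g,
      LinearMap.comp_assoc A.d s g, ← smul_add, ← LinearMap.comp_add, hs, LinearMap.comp_id]
  have hlift : tensorD C.toDGModule V ∘ₗ cofreeLift (q + 1) A.coact (g ∘ₗ s) +
      (-1 : k) ^ q • (cofreeLift (q + 1) A.coact (g ∘ₗ s) ∘ₗ A.d) =
        cofreeLift q A.coact ((-1 : k) ^ q • g) :=
    hgs_d ▸ tensorD_comp_map_parity_comp A.coact_comp_d
  refine ⟨cofreeLift (q + 1) A.coact (g ∘ₗ s), fun n x hx => ?_,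
    isKoszulColinear_cofreeLift A.coassoc _, ?_⟩
  · rw [sub_sub, sub_eq_add_neg]
    refine cofreeLift_mem (fun m y hy => ?_) hx
    rw [← sub_eq_add_neg, ← sub_sub]
    exact DGCoalgebra.counitTensor_mem V (hf_mem _ _ (hs_mem m y hy))
  · have hlift' := congrArg ((-1 : k) ^ q • ·) hlift
    simp only [smul_add, smul_smul, neg_one_pow_mul_self, one_smul, cofreeLift_smul, hg,
      cofreeLift_counitTensor_comp hf] at hlift'
    exact hlift'

end ExactComodule

section Cobar

variable (M : DGComodule.{u, v} C)

theorem isKoszulColinear_incl (j : ℕ) :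
    IsKoszulColinear j (C.comulTensor (M.power j).carrier) M.cobarCoact (M.incl j) :=
  LinearMap.ext (M.cobarCoact_incl j)

theorem isKoszulColinear_component (j : ℕ) :
    IsKoszulColinear j M.cobarCoact (C.comulTensor (M.power j).carrier)
      (component k ℕ (fun n => M.summand n) j) := by
  refine DirectSum.linearMap_ext _ fun n => ?_
  have hincl : M.cobarCoact ∘ₗ M.incl n = TensorProduct.map (C.parity ^ n) (M.incl n) ∘ₗ
      C.comulTensor (M.power n).carrier := isKoszulColinear_incl M n
  rw [LinearMap.comp_assoc, LinearMap.comp_assoc, hincl,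
    ← LinearMap.comp_assoc (C.comulTensor _), ← TensorProduct.map_comp]
  obtain rfl | hn := eq_or_ne n j
  · have hid : component k ℕ (fun n => M.summand n) n ∘ₗ M.incl n = LinearMap.id :=
      LinearMap.ext fun x => component.lof_self k (M := fun n => (M.summand n).carrier) n x
    rw [hid, ← Module.End.mul_eq_comp, parity_pow_mul_self, Module.End.one_eq_id,
      TensorProduct.map_id, LinearMap.comp_id, LinearMap.id_comp]
  · have hzero : component k ℕ (fun n => M.summand n) j ∘ₗ M.incl n = 0 :=
      LinearMap.ext fun x => by simp [component.of, hn]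
    rw [hzero, LinearMap.comp_zero, TensorProduct.map_zero_right, LinearMap.zero_comp]

variable {M} {A : DGComodule.{u, v} C}

theorem exists_homotopy_component_sub_eq_zero (hA : Function.Exact A.d A.d) {j : ℕ}
    {f : A.carrier →ₗ[k] ⨁ n, M.summand n} (hf : IsKoszulColinear 0 A.coact M.cobarCoact f)
    (hf_mem : ∀ n, ∀ x ∈ A.deg n, f x ∈ totalDeg M.summand n)
    (hf_d : f ∘ₗ A.d = totalD M.summand M.bPrime ∘ₗ f) (hfj : ∀ x, f x ∈ totalFilt M.summand j) :
    ∃ h : A.carrier →ₗ[k] M.summand j,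
      (∀ n, ∀ x ∈ A.deg n, h x ∈ (M.summand j).deg (n - 1 - j)) ∧
      IsKoszulColinear (j + 1) A.coact (C.comulTensor (M.power j).carrier) h ∧
      ∀ x, component k ℕ (fun n => M.summand n) j
        (f x - (M.incl j (h (A.d x)) + totalD M.summand M.bPrime (M.incl j (h x)))) = 0 := by
  have hcomp := (isKoszulColinear_component M j).comp hf
  rw [add_zero] at hcomp
  obtain ⟨h, hh_mem, hh, hbdry⟩ := exists_homotopy_of_exact hA hcomp
    (fun n x hx => component_mem (hf_mem n x hx) j) (by
      rw [LinearMap.comp_assoc, hf_d]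
      exact LinearMap.ext fun x => component_totalD (hfj x))
  refine ⟨h, hh_mem, hh, fun x => ?_⟩
  have hx : (-1 : k) ^ j • (M.summand j).d (h x) + h (A.d x) =
      component k ℕ (fun n => M.summand n) j (f x) := LinearMap.congr_fun hbdry x
  have hd := component_totalD (β := M.bPrime) (lof_mem_totalFilt (X := M.summand) j (h x))
  rw [component.lof_self] at hd
  rw [map_sub, map_add, hd, component.lof_self, ← hx, add_comm, sub_self]

theorem exists_homotopy_cobar_totalFilt (hA : Function.Exact A.d A.d) {j : ℕ}
    {f : A.carrier →ₗ[k] M.cobar.carrier} (hf : f ∈ chainMaps A M.cobar)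
    (hfj : LinearMap.range f ≤ totalFilt M.summand j) :
    ∃ h ∈ homotopies A M.cobar, LinearMap.range h ≤ totalFilt M.summand j ∧
      LinearMap.range (f - homotopyBoundary A M.cobar h) ≤ totalFilt M.summand (j + 1) := by
  have hfx (x : A.carrier) : f x ∈ totalFilt M.summand j := hfj (LinearMap.mem_range_self f x)
  obtain ⟨h, hh_mem, hh, hbdry⟩ := exists_homotopy_component_sub_eq_zero hA hf.2.2 hf.1 hf.2.1 hfx
  have hhj (x : A.carrier) : M.incl j (h x) ∈ totalFilt M.summand j := lof_mem_totalFilt j (h x)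
  refine ⟨M.incl j ∘ₗ h, ⟨fun n x hx => ?_, ?_⟩, ?_, ?_⟩
  · exact lof_mem_totalDeg M.summand (by omega) (hh_mem n x hx)
  · rw [← isKoszulColinear_add_two_mul_iff j, show 1 + 2 * j = j + (j + 1) by omega]
    exact (isKoszulColinear_incl M j).comp hh
  · exact LinearMap.range_le_iff_comap.2 (eq_top_iff.2 fun x _ => hhj x)
  · refine LinearMap.range_le_iff_comap.2 (eq_top_iff.2 fun x _ =>
      mem_totalFilt_succ.2 ⟨Submodule.sub_mem _ (hfx x) ?_, hbdry x⟩)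
    exact Submodule.add_mem _ (hhj (A.d x)) (totalD_mem_totalFilt (hhj x))

theorem summand_deg_eq_bot (hC : C.PositivelyGraded) {n₀ : ℤ} (hM : ∀ n < n₀, M.deg n = ⊥)
    (j : ℕ) : ∀ n < n₀, (M.summand j).deg n = ⊥ := by
  have hpower (j : ℕ) : ∀ n < n₀, (M.power j).deg n = ⊥ := by
    induction j with
    | zero => exact hM
    | succ j ih => exact fun n hn => tensorDeg_eq_bot hC ih (by rwa [zero_add])
  exact fun n hn => tensorDeg_eq_bot hC (hpower j) (by rwa [zero_add])

end Cobar

/-- Every morphism from an acyclic comodule to `X` is null-homotopic. -/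
def IsKInjective (X : DGComodule.{u, v} C) : Prop :=
  ∀ A : DGComodule.{u, v} C, Function.Exact A.d A.d → chainMaps A X ≤ nullHomotopic A X

theorem isKInjective_cobar (hC : C.PositivelyGraded) {M : DGComodule.{u, v} C}
    (hM : M.LeftBounded) : IsKInjective M.cobar := by
  obtain ⟨n₀, hn₀⟩ := hM
  refine fun A hA => chainMaps_le_nullHomotopic_of_filtration (F := totalFilt M.summand)
    totalFilt_zero (fun n => ?_) fun j f hf hfj => exists_homotopy_cobar_totalFilt hA hf hfj
  filter_upwards [eventually_gt_atTop (n - n₀).toNat] with j hj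
  exact disjoint_totalFilt_totalDeg (summand_deg_eq_bot hC hn₀) (by omega)

theorem leftBounded_cobar (hC : C.PositivelyGraded) {M : DGComodule.{u, v} C}
    (hM : M.LeftBounded) : M.cobar.LeftBounded := by
  obtain ⟨n₀, hn₀⟩ := hM
  exact ⟨n₀, fun n hn => totalDeg_eq_bot (summand_deg_eq_bot hC hn₀) hn⟩

section Grading

variable {R ι κ V W : Type*} [Ring R] [DecidableEq ι] [DecidableEq κ] [AddCommGroup V]
  [Module R V] [AddCommGroup W] [Module R W] {F : ι → Submodule R V} {G : ι → Submodule R W}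

theorem isInternal_comp_equiv (hF : DirectSum.IsInternal F) (e : κ ≃ ι) :
    DirectSum.IsInternal fun n => F (e n) :=
  DirectSum.isInternal_submodule_of_iSupIndep_of_iSup_eq_top
    (hF.submodule_iSupIndep.comp e.injective)
    ((e.iSup_comp (g := F)).trans hF.submodule_iSup_eq_top)

theorem isInternal_prod (hF : DirectSum.IsInternal F) (hG : DirectSum.IsInternal G) :
    DirectSum.IsInternal fun n => (F n).prod (G n) := by
  refine DirectSum.isInternal_submodule_of_iSupIndep_of_iSup_eq_top (fun n => ?_) ?_
  · have hle : ⨆ j, ⨆ (_ : j ≠ n), (F j).prod (G j) ≤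
        (⨆ j, ⨆ (_ : j ≠ n), F j).prod (⨆ j, ⨆ (_ : j ≠ n), G j) :=
      iSup₂_le fun j hj => Submodule.prod_mono (le_iSup₂_of_le j hj le_rfl)
        (le_iSup₂_of_le j hj le_rfl)
    refine Disjoint.mono_right hle ?_
    rw [disjoint_iff, Submodule.prod_inf_prod, (hF.submodule_iSupIndep n).eq_bot,
      (hG.submodule_iSupIndep n).eq_bot, Submodule.prod_bot]
  · simp only [LinearMap.prod_eq_sup_map, iSup_sup_eq, ← Submodule.map_iSup,
      hF.submodule_iSup_eq_top, hG.submodule_iSup_eq_top, Submodule.map_top,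
      LinearMap.sup_range_inl_inr]

end Grading

section Shift

/-- The coaction `m ↦ ∑ (-1)^|c| c ⊗ m'` of the shift of a comodule, where `∑ c ⊗ m'` is the
coaction of the comodule itself. -/
def shiftCoact {A : Type v} [AddCommGroup A] [Module k A] (α : A →ₗ[k] C.carrier ⊗[k] A) :
    A →ₗ[k] C.carrier ⊗[k] A :=
  TensorProduct.map C.parity LinearMap.id ∘ₗ α

theorem isKoszulColinear_shiftCoact_iff {A B : Type v} [AddCommGroup A] [Module k A]
    [AddCommGroup B] [Module k B] {q : ℕ} {α : A →ₗ[k] C.carrier ⊗[k] A}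
    {β : B →ₗ[k] C.carrier ⊗[k] B} {f : A →ₗ[k] B} :
    IsKoszulColinear q (shiftCoact α) β f ↔ IsKoszulColinear (q + 1) α β f := by
  rw [IsKoszulColinear, IsKoszulColinear, shiftCoact, ← LinearMap.comp_assoc,
    ← TensorProduct.map_comp, LinearMap.comp_id, pow_succ, Module.End.mul_eq_comp]

theorem isKoszulColinear_id_shiftCoact {A : Type v} [AddCommGroup A] [Module k A]
    (α : A →ₗ[k] C.carrier ⊗[k] A) : IsKoszulColinear 1 α (shiftCoact α) LinearMap.id :=
  isKoszulColinear_one_iff.2 (LinearMap.comp_id _)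

/-- The complex `A[-1]`, with `A[-1]_n = A_{n - 1}` and the differential `-d`. -/
abbrev DGModule.shift (A : DGModule.{u, v} k) : DGModule.{u, v} k where
  carrier := A.carrier
  deg n := A.deg (n - 1)
  isInternal := isInternal_comp_equiv A.isInternal (Equiv.subRight 1)
  d := -A.d
  d_mem {n x} hx := by
    have h := Submodule.neg_mem _ (A.d_mem hx)
    rwa [sub_add_cancel, ← add_sub_cancel_right n 1] at h
  d_comp_d := by rw [LinearMap.neg_comp, LinearMap.comp_neg, neg_neg, A.d_comp_d]

/-- The comodule `A[-1]`, on which the coaction of `A` is twisted by the sign `(-1)^|c|`. -/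
abbrev DGComodule.shift (A : DGComodule.{u, v} C) : DGComodule.{u, v} C where
  toDGModule := A.toDGModule.shift
  coact := shiftCoact A.coact
  coact_mem {n x} hx := by
    have hA : A.coact x ∈ tensorDeg C.toDGModule A.toDGModule (n - 1) := A.coact_mem hx
    have hmap : ∀ m, ∀ y ∈ A.deg m, LinearMap.id (R := k) y ∈ A.toDGModule.shift.deg (m + 1) :=
      fun m y hy => by
        rw [← add_sub_cancel_right m 1] at hy
        exact hy
    exact map_mem_tensorDeg (a := 0) (fun m c hc => (add_zero m).symm ▸ C.parity_mem hc) hmap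
      (by omega) hA
  coact_comp_d := by
    have hid := isKoszulColinear_id_shiftCoact A.coact
    have hzero : A.toDGModule.shift.d ∘ₗ LinearMap.id +
        (-1 : k) ^ 0 • (LinearMap.id ∘ₗ A.toDGModule.d) = 0 := by
      rw [pow_zero, one_smul, LinearMap.comp_id, LinearMap.id_comp, neg_add_cancel]
    exact IsKoszulColinear.coact_comp_d_comp (B := A.toDGModule.shift) A.coact_comp_d hid
      (hzero ▸ .zero)
  coassoc := (isKoszulColinear_id_shiftCoact A.coact).coassoc_comp A.coassoc
  counit_coact := (isKoszulColinear_id_shiftCoact A.coact).counitTensor_comp A.counit_coact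

end Shift

section Cone

section Coaction

variable {A B X : Type v} [AddCommGroup A] [Module k A] [AddCommGroup B] [Module k B]
  [AddCommGroup X] [Module k X] (α : A →ₗ[k] C.carrier ⊗[k] A) (β : B →ₗ[k] C.carrier ⊗[k] B)

/-- The coaction `(b, a) ↦ ∑ c ⊗ (b', 0) + ∑ (-1)^|c| c ⊗ (0, a')` of a mapping cone. -/
def coneCoact : B × A →ₗ[k] C.carrier ⊗[k] (B × A) :=
  (TensorProduct.map LinearMap.id (LinearMap.inl k B A) ∘ₗ β).coprod
    (TensorProduct.map C.parity (LinearMap.inr k B A) ∘ₗ α)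

theorem isKoszulColinear_inl : IsKoszulColinear 0 β (coneCoact α β) (LinearMap.inl k B A) :=
  LinearMap.coprod_inl _ _

theorem isKoszulColinear_inr : IsKoszulColinear 1 α (coneCoact α β) (LinearMap.inr k B A) :=
  isKoszulColinear_one_iff.2 (LinearMap.coprod_inr _ _)

variable {α β} {ξ : X →ₗ[k] C.carrier ⊗[k] X} {q : ℕ}

theorem IsKoszulColinear.coprod {f : B →ₗ[k] X} {g : A →ₗ[k] X} (hf : IsKoszulColinear q β ξ f)
    (hg : IsKoszulColinear (q + 1) α ξ g) :
    IsKoszulColinear q (coneCoact α β) ξ (f.coprod g) := by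
  have hinl := isKoszulColinear_inl α β
  have hinr := isKoszulColinear_inr α β
  refine LinearMap.prod_ext ?_ ?_
  · rw [LinearMap.comp_assoc, LinearMap.coprod_inl, hf, LinearMap.comp_assoc, hinl,
      ← LinearMap.comp_assoc, ← TensorProduct.map_comp, LinearMap.coprod_inl, pow_zero,
      ← Module.End.mul_eq_comp, mul_one]
  · rw [LinearMap.comp_assoc, LinearMap.coprod_inr, hg, LinearMap.comp_assoc, hinr,
      ← LinearMap.comp_assoc, ← TensorProduct.map_comp, LinearMap.coprod_inr,
      ← Module.End.mul_eq_comp, ← pow_add]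

end Coaction

variable {A B : DGComodule.{u, v} C} (s : A ⟶ B)

/-- The complex underlying the mapping cone of `s : A → B`: in degree `n` it is
`B_n × A_{n + 1}`, with differential `(b, a) ↦ (d b + s a, -d a)`. -/
abbrev coneComplex : DGModule.{u, v} k where
  carrier := B.carrier × A.carrier
  deg n := (B.deg n).prod (A.deg (n + 1))
  isInternal := isInternal_prod B.isInternal
    (isInternal_comp_equiv A.isInternal (Equiv.addRight 1))
  d := (B.d.coprod (DGPrecomodule.Hom.lin s)).prod (-A.d ∘ₗ LinearMap.snd k B.carrier A.carrier)
  d_mem hx := ⟨Submodule.add_mem _ (B.d_mem hx.1) (DGPrecomodule.Hom.map_mem s hx.2),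
    Submodule.neg_mem _ (A.d_mem hx.2)⟩
  d_comp_d := by
    have hB : ∀ b, B.d (B.d b) = 0 := LinearMap.congr_fun B.d_comp_d
    have hA : ∀ a, A.d (A.d a) = 0 := LinearMap.congr_fun A.d_comp_d
    have hs : ∀ a, DGPrecomodule.Hom.lin s (A.d a) = B.d (DGPrecomodule.Hom.lin s a) :=
      LinearMap.congr_fun (DGPrecomodule.Hom.comp_d s)
    exact LinearMap.ext fun x => Prod.ext (by simp [hB, hs]) (by simp [hA])

theorem coneComplex_d_comp_inl : (coneComplex s).d ∘ₗ LinearMap.inl k B.carrier A.carrier =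
    LinearMap.inl k B.carrier A.carrier ∘ₗ B.d :=
  LinearMap.ext fun b => Prod.ext (by simp) (by simp)

theorem coneComplex_d_comp_inr : (coneComplex s).d ∘ₗ LinearMap.inr k B.carrier A.carrier =
    LinearMap.inl k B.carrier A.carrier ∘ₗ DGPrecomodule.Hom.lin s -
      LinearMap.inr k B.carrier A.carrier ∘ₗ A.d :=
  LinearMap.ext fun a => Prod.ext (by simp) (by simp)

/-- The mapping cone of a morphism of comodules. -/
abbrev cone : DGComodule.{u, v} C where
  toDGModule := coneComplex s
  coact := coneCoact A.coact B.coact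
  coact_mem {n x} hx := by
    refine Submodule.add_mem _ ?_ ?_
    · exact map_mem_tensorDeg (a := 0) (b := 0) (W' := coneComplex s)
        (fun m c hc => (add_zero m).symm ▸ hc)
        (fun m y hy => (add_zero m).symm ▸ ⟨hy, Submodule.zero_mem _⟩) (by omega)
        (B.coact_mem hx.1)
    · exact map_mem_tensorDeg (a := 0) (b := -1) (W' := coneComplex s)
        (fun m c hc => (add_zero m).symm ▸ C.parity_mem hc)
        (fun m y hy => ⟨Submodule.zero_mem _, (neg_add_cancel_right m 1).symm ▸ hy⟩)
        (by omega) (A.coact_mem hx.2)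
  coact_comp_d := by
    have hinl := isKoszulColinear_inl A.coact B.coact
    have hinr := isKoszulColinear_inr A.coact B.coact
    have hs : IsKoszulColinear 0 A.coact B.coact (DGPrecomodule.Hom.lin s) :=
      DGPrecomodule.Hom.colinear s
    refine LinearMap.prod_ext ?_ ?_
    · have hd := DGPrecomodule.map_id_comp_tensorD (V := C.toDGModule) (W := B.toDGModule)
        (W' := coneComplex s) (coneComplex_d_comp_inl s).symm
      rw [LinearMap.comp_assoc, coneComplex_d_comp_inl, ← LinearMap.comp_assoc, hinl,
        LinearMap.comp_assoc, B.coact_comp_d, LinearMap.comp_assoc, hinl]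
      exact congrArg (· ∘ₗ B.coact) hd
    · refine IsKoszulColinear.coact_comp_d_comp (B := coneComplex s) A.coact_comp_d hinr ?_
      have hcomp := hinl.comp hs
      rw [add_zero] at hcomp
      rwa [coneComplex_d_comp_inr, pow_zero, one_smul, sub_add_cancel]
  coassoc := LinearMap.prod_ext ((isKoszulColinear_inl _ _).coassoc_comp B.coassoc)
    ((isKoszulColinear_inr _ _).coassoc_comp A.coassoc)
  counit_coact := LinearMap.prod_ext ((isKoszulColinear_inl _ _).counitTensor_comp B.counit_coact)
    ((isKoszulColinear_inr _ _).counitTensor_comp A.counit_coact)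

end Cone

theorem quasiIso_iff {M N : DGComodule.{u, v} C} {f : M ⟶ N} : QuasiIso f ↔
    (∀ x, M.d x = 0 → DGPrecomodule.Hom.lin f x ∈ LinearMap.range N.d →
      x ∈ LinearMap.range M.d) ∧
    ∀ y, N.d y = 0 → ∃ x, M.d x = 0 ∧ DGPrecomodule.Hom.lin f x - y ∈ LinearMap.range N.d := by
  have hinj : Function.Injective (homologyMap f) ↔ ∀ x, M.d x = 0 →
      DGPrecomodule.Hom.lin f x ∈ LinearMap.range N.d → x ∈ LinearMap.range M.d := by
    rw [injective_iff_map_eq_zero, (Submodule.Quotient.mk_surjective _).forall, Subtype.forall]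
    refine forall₂_congr fun x hx => imp_congr ?_ ?_ <;> exact Submodule.Quotient.mk_eq_zero _
  have hsurj : Function.Surjective (homologyMap f) ↔ ∀ y, N.d y = 0 →
      ∃ x, M.d x = 0 ∧ DGPrecomodule.Hom.lin f x - y ∈ LinearMap.range N.d := by
    rw [Function.Surjective, (Submodule.Quotient.mk_surjective _).forall, Subtype.forall]
    refine forall₂_congr fun y hy => ?_
    rw [(Submodule.Quotient.mk_surjective _).exists, Subtype.exists]
    exact exists_congr fun x => (exists_congr fun hx => Submodule.Quotient.eq
      (p := (LinearMap.range N.d).comap (LinearMap.ker N.d).subtype)).trans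
      ⟨fun ⟨hx, h⟩ => ⟨hx, h⟩, fun ⟨hx, h⟩ => ⟨hx, h⟩⟩
  rw [QuasiIso, Function.Bijective, hinj, hsurj]

theorem quasiIso_of_contraction {M N : DGComodule.{u, v} C} {f : M ⟶ N}
    {r : N.carrier →ₗ[k] M.carrier} {t : N.carrier →ₗ[k] N.carrier}
    (hrd : r ∘ₗ N.d = M.d ∘ₗ r) (hrf : r ∘ₗ DGPrecomodule.Hom.lin f = LinearMap.id)
    (ht : N.d ∘ₗ t + t ∘ₗ N.d = LinearMap.id - DGPrecomodule.Hom.lin f ∘ₗ r) : QuasiIso f := by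
  have hrd : ∀ y, r (N.d y) = M.d (r y) := LinearMap.congr_fun hrd
  have hrf : ∀ x, r (DGPrecomodule.Hom.lin f x) = x := LinearMap.congr_fun hrf
  refine quasiIso_iff.2 ⟨?_, fun y hy => ⟨r y, ?_, -t y, ?_⟩⟩
  · rintro x - ⟨y, hy⟩
    exact ⟨r y, by rw [← hrd, hy, hrf]⟩
  · rw [← hrd, hy, map_zero]
  · have hty := LinearMap.congr_fun ht y
    simp only [LinearMap.add_apply, LinearMap.sub_apply, LinearMap.comp_apply, hy, map_zero,
      add_zero, LinearMap.id_apply] at hty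
    rw [map_neg, hty, neg_sub]

theorem exact_shift_d {A : DGModule.{u, v} k} (hA : Function.Exact A.d A.d) :
    Function.Exact A.shift.d A.shift.d := fun x => by
  rw [LinearMap.neg_apply, neg_eq_zero, hA x]
  exact neg_surjective.exists.trans (by simp)

theorem exact_coneComplex_d {A B : DGComodule.{u, v} C} {s : A ⟶ B} (hs : QuasiIso s) :
    Function.Exact (coneComplex s).d (coneComplex s).d := by
  obtain ⟨hinj, hsurj⟩ := quasiIso_iff.1 hs
  have hsd : ∀ x, DGPrecomodule.Hom.lin s (A.d x) = B.d (DGPrecomodule.Hom.lin s x) :=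
    LinearMap.congr_fun (DGPrecomodule.Hom.comp_d s)
  refine fun z => ⟨fun hz => ?_, ?_⟩
  · obtain ⟨b, a⟩ := z
    have hb : B.d b + DGPrecomodule.Hom.lin s a = 0 := congrArg Prod.fst hz
    have ha : A.d a = 0 := neg_eq_zero.1 (congrArg Prod.snd hz)
    obtain ⟨a₁, rfl⟩ := hinj a ha ⟨-b, by rw [map_neg, neg_eq_of_add_eq_zero_right hb]⟩
    obtain ⟨a₂, ha₂, b₁, hb₁⟩ := hsurj (b + DGPrecomodule.Hom.lin s a₁) (by rw [map_add, ← hsd, hb])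
    refine ⟨(-b₁, a₂ - a₁), Prod.ext ?_ ?_⟩
    · change B.d (-b₁) + DGPrecomodule.Hom.lin s (a₂ - a₁) = b
      rw [map_neg, map_sub, hb₁]
      abel
    · change -A.d (a₂ - a₁) = A.d a₁
      rw [map_sub, ha₂, zero_sub, neg_neg]
  · rintro ⟨w, rfl⟩
    exact LinearMap.congr_fun (coneComplex s).d_comp_d w

section DegreeOne

variable {A B X : DGComodule.{u, v} C}

theorem coprod_zero_comp_coneComplex_d (s : A ⟶ B) {f : A.carrier →ₗ[k] X.carrier}
    (hf : f ∘ₗ A.d = X.d ∘ₗ f) :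
    (0 : B.carrier →ₗ[k] X.carrier).coprod f ∘ₗ (coneComplex s).d =
      -(X.d ∘ₗ (0 : B.carrier →ₗ[k] X.carrier).coprod f) := by
  have hf : ∀ a, f (A.d a) = X.d (f a) := LinearMap.congr_fun hf
  exact LinearMap.ext fun x => by simp [hf]

theorem homotopy_coprod_zero_components {s : A ⟶ B} {f : A.carrier →ₗ[k] X.carrier}
    {H : B.carrier × A.carrier →ₗ[k] X.carrier}
    (hH : (0 : B.carrier →ₗ[k] X.carrier).coprod f = X.d ∘ₗ H - H ∘ₗ (coneComplex s).d) :
    (H ∘ₗ LinearMap.inl k B.carrier A.carrier) ∘ₗ B.d =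
        X.d ∘ₗ H ∘ₗ LinearMap.inl k B.carrier A.carrier ∧
      f + (H ∘ₗ LinearMap.inl k B.carrier A.carrier) ∘ₗ DGPrecomodule.Hom.lin s =
        (H ∘ₗ LinearMap.inr k B.carrier A.carrier) ∘ₗ A.d +
          X.d ∘ₗ H ∘ₗ LinearMap.inr k B.carrier A.carrier := by
  have hinl := congrArg (· ∘ₗ LinearMap.inl k B.carrier A.carrier) hH
  have hinr := congrArg (· ∘ₗ LinearMap.inr k B.carrier A.carrier) hH
  simp only [LinearMap.coprod_inl, LinearMap.coprod_inr, LinearMap.sub_comp,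
    LinearMap.comp_assoc] at hinl hinr
  rw [coneComplex_d_comp_inl] at hinl
  rw [coneComplex_d_comp_inr, LinearMap.comp_sub] at hinr
  refine ⟨(sub_eq_zero.1 hinl.symm).symm, ?_⟩
  rw [hinr]
  simp only [LinearMap.comp_assoc]
  abel

end DegreeOne

namespace IsKInjective

variable {A B X : DGComodule.{u, v} C} {s : A ⟶ B}

theorem mem_nullHomotopic_of_comp (hX : IsKInjective X) (hs : QuasiIso s)
    {g : B.carrier →ₗ[k] X.carrier} (hg : g ∈ chainMaps B X)
    (hgs : g ∘ₗ DGPrecomodule.Hom.lin s ∈ nullHomotopic A X) : g ∈ nullHomotopic B X := by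
  obtain ⟨h, hh, hgs⟩ := mem_nullHomotopic.1 hgs
  have hF : g.coprod h ∈ chainMaps (cone s) X := by
    refine ⟨fun n x hx => ?_, LinearMap.prod_ext ?_ ?_, hg.2.2.coprod hh.2⟩
    · have hhx := hh.1 _ _ hx.2
      rw [add_sub_cancel_right] at hhx
      exact Submodule.add_mem _ (hg.1 _ _ hx.1) hhx
    · rw [LinearMap.comp_assoc, coneComplex_d_comp_inl, LinearMap.comp_assoc,
        LinearMap.coprod_inl, ← LinearMap.comp_assoc, LinearMap.coprod_inl, hg.2.1]
    · rw [LinearMap.comp_assoc, coneComplex_d_comp_inr, LinearMap.comp_sub,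
        ← LinearMap.comp_assoc, ← LinearMap.comp_assoc, LinearMap.coprod_inl,
        LinearMap.coprod_inr, LinearMap.comp_assoc, LinearMap.coprod_inr, hgs, add_sub_cancel_left]
  obtain ⟨H, hH, hFH⟩ := mem_nullHomotopic.1 (hX _ (exact_coneComplex_d hs) hF)
  have hHinl : IsKoszulColinear (1 + 0) B.coact X.coact
      (H ∘ₗ LinearMap.inl k B.carrier A.carrier) :=
    hH.2.comp (isKoszulColinear_inl _ _)
  rw [add_zero] at hHinl
  refine mem_nullHomotopic.2 ⟨H ∘ₗ LinearMap.inl k B.carrier A.carrier,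
    ⟨fun n x hx => hH.1 n (x, 0) ⟨hx, Submodule.zero_mem _⟩, hHinl⟩, ?_⟩
  rw [← LinearMap.coprod_inl g h, hFH, LinearMap.add_comp, LinearMap.comp_assoc,
    coneComplex_d_comp_inl, LinearMap.comp_assoc, LinearMap.comp_assoc]

theorem exists_homotopy_of_degree_one (hX : IsKInjective X) (hA : Function.Exact A.d A.d)
    {f : A.carrier →ₗ[k] X.carrier} (hdeg : ∀ n, ∀ x ∈ A.deg n, f x ∈ X.deg (n + 1))
    (hco : IsKoszulColinear 1 A.coact X.coact f) (hfd : f ∘ₗ A.d = -(X.d ∘ₗ f)) :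
    ∃ H : A.carrier →ₗ[k] X.carrier, (∀ n, ∀ x ∈ A.deg n, H x ∈ X.deg n) ∧
      IsKoszulColinear 0 A.coact X.coact H ∧ f = X.d ∘ₗ H - H ∘ₗ A.d := by
  have hf : f ∈ chainMaps A.shift X := by
    refine ⟨fun n x hx => ?_, ?_, isKoszulColinear_shiftCoact_iff.2 hco⟩
    · have hfx := hdeg _ x hx
      rwa [sub_add_cancel] at hfx
    · rw [LinearMap.comp_neg, hfd, neg_neg]
  obtain ⟨H, hH, hfH⟩ := mem_nullHomotopic.1 (hX _ (exact_shift_d hA) hf)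
  refine ⟨H, fun n x hx => ?_,
    (isKoszulColinear_add_two_mul_iff 1).1 (isKoszulColinear_shiftCoact_iff.1 hH.2), ?_⟩
  · rw [← add_sub_cancel_right n 1] at hx ⊢
    exact hH.1 _ x hx
  · rw [hfH, LinearMap.comp_neg, neg_add_eq_sub]

theorem exists_sub_comp_mem_nullHomotopic (hX : IsKInjective X) (hs : QuasiIso s)
    {f : A.carrier →ₗ[k] X.carrier} (hf : f ∈ chainMaps A X) :
    ∃ g ∈ chainMaps B X, f - g ∘ₗ DGPrecomodule.Hom.lin s ∈ nullHomotopic A X := by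
  -- Extended by zero to the cone, `f` has degree `1`; a null-homotopy of it restricts on `B` to the
  -- required extension of `f` along `s` up to sign, and on `A` to the homotopy.
  have hco : IsKoszulColinear 1 (cone s).coact X.coact
      ((0 : B.carrier →ₗ[k] X.carrier).coprod f) :=
    IsKoszulColinear.zero.coprod ((isKoszulColinear_add_two_mul_iff 1).2 hf.2.2)
  obtain ⟨H, hHdeg, hHco, hfH⟩ := hX.exists_homotopy_of_degree_one (exact_coneComplex_d hs)
    (fun n x hx => by simpa using hf.1 _ _ hx.2) hco (coprod_zero_comp_coneComplex_d s hf.2.1)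
  obtain ⟨hgd, hfh⟩ := homotopy_coprod_zero_components hfH
  have hg : IsKoszulColinear (0 + 0) B.coact X.coact (H ∘ₗ LinearMap.inl k B.carrier A.carrier) :=
    hHco.comp (isKoszulColinear_inl _ _)
  have hh : IsKoszulColinear (0 + 1) A.coact X.coact (H ∘ₗ LinearMap.inr k B.carrier A.carrier) :=
    hHco.comp (isKoszulColinear_inr _ _)
  have hhdeg : ∀ n, ∀ x ∈ A.deg n, H (0, x) ∈ X.deg (n - 1) := fun n x hx => by
    rw [← sub_add_cancel n 1] at hx
    exact hHdeg (n - 1) (0, x) ⟨Submodule.zero_mem _, hx⟩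
  rw [add_zero] at hg
  rw [zero_add] at hh
  refine ⟨-(H ∘ₗ LinearMap.inl k B.carrier A.carrier), Submodule.neg_mem _
    ⟨fun n x hx => hHdeg n (x, 0) ⟨hx, Submodule.zero_mem _⟩, hgd, hg⟩,
    mem_nullHomotopic.2 ⟨H ∘ₗ LinearMap.inr k B.carrier A.carrier, ⟨hhdeg, hh⟩, ?_⟩⟩
  rw [LinearMap.neg_comp, sub_neg_eq_add, hfh]

theorem isLocal (hX : IsKInjective X) : (quasiIsos C).isLocal ((toH C).obj X) := by
  rintro A B _ ⟨s, rfl, hs⟩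
  constructor
  · intro φ ψ h
    obtain ⟨g, rfl⟩ := (toH C).map_surjective φ
    obtain ⟨g', rfl⟩ := (toH C).map_surjective ψ
    have h : (toH C).map (s ≫ g) = (toH C).map (s ≫ g') := by
      simpa only [Functor.map_comp] using h
    refine CategoryTheory.Quotient.sound _ (homotopic_iff.2 (hX.mem_nullHomotopic_of_comp hs
      (Submodule.sub_mem _ (lin_mem_chainMaps g) (lin_mem_chainMaps g')) ?_))
    rw [LinearMap.sub_comp]
    exact homotopic_iff.1 ((CategoryTheory.Quotient.functor_map_eq_iff _ _ _).1 h)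
  · intro φ
    obtain ⟨f, rfl⟩ := (toH C).map_surjective φ
    obtain ⟨g, hg, hfg⟩ := hX.exists_sub_comp_mem_nullHomotopic hs (lin_mem_chainMaps f)
    have hsg : (toH C).map f = (toH C).map (s ≫ homOfMemChainMaps hg) :=
      CategoryTheory.Quotient.sound _ (homotopic_iff.2 hfg)
    exact ⟨(toH C).map (homOfMemChainMaps hg), ((hsg.trans ((toH C).map_comp _ _)).symm)⟩

theorem isClosedObj (hX : IsKInjective X) : IsClosedObj X := fun N =>
  bijective_Q_map_of_isLocal hX.isLocal ((toH C).obj N)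

end IsKInjective

theorem counitTensor_comp_bar (W : DGPrecomodule.{u, v} C) :
    C.counitTensor (C.carrier ⊗[k] W.carrier) ∘ₗ W.bar =
      LinearMap.id - W.coact ∘ₗ C.counitTensor W.carrier := by
  rw [DGPrecomodule.bar, LinearMap.comp_sub, DGCoalgebra.counitTensor_comp_comulTensor]
  exact congrArg (LinearMap.id - ·) (DGCoalgebra.counitTensor_comp_map_parity 0 W.coact)

section Contraction

variable (M : DGComodule.{u, v} C)

/-- The retraction `ε ⊗ id : C ⊗ M → M` of the standard resolution to `M`. -/
def cobarRetraction : (⨁ n, M.summand n) →ₗ[k] M.carrier :=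
  C.counitTensor M.carrier ∘ₗ component k ℕ (fun n => M.summand n) 0

/-- The map `(c_1, …, c_{n + 2}, m) ↦ ε(c_1) (c_2, …, c_{n + 2}, m)`. -/
def counitStep (n : ℕ) : M.summand (n + 1) →ₗ[k] M.summand n :=
  C.counitTensor (M.power (n + 1)).carrier

/-- The contraction of the standard resolution to `M`, given by `counitStep` and by `0` on the
first summand. -/
def cobarContraction : (⨁ n, M.summand n) →ₗ[k] ⨁ n, M.summand n :=
  toModule k ℕ _ fun n =>
    match n with
    | 0 => 0
    | n + 1 => M.incl n ∘ₗ counitStep M n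

theorem counitStep_d (n : ℕ) (x : M.summand (n + 1)) :
    counitStep M n ((M.summand (n + 1)).d x) = (M.summand n).d (counitStep M n x) :=
  LinearMap.congr_fun (DGCoalgebra.counitTensor_comp_tensorD (M.summand n)) x

theorem counitStep_bPrime_zero (x : M.summand 0) :
    counitStep M 0 (M.bPrime 0 x) = x - M.coactZero (C.counitTensor M.carrier x) :=
  LinearMap.congr_fun (counitTensor_comp_bar (M.power 0)) x

theorem counitStep_bPrime_succ (n : ℕ) (x : M.summand (n + 1)) :
    counitStep M (n + 1) (M.bPrime (n + 1) x) = x - M.bPrime n (counitStep M n x) :=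
  LinearMap.congr_fun (counitTensor_comp_bar (M.power (n + 1))) x

theorem cobarRetraction_incl_zero (x : M.summand 0) :
    cobarRetraction M (M.incl 0 x) = C.counitTensor M.carrier x :=
  congrArg (C.counitTensor M.carrier)
    (component.lof_self k (M := fun n => (M.summand n).carrier) 0 x)

theorem cobarRetraction_incl_succ (n : ℕ) (x : M.summand (n + 1)) :
    cobarRetraction M (M.incl (n + 1) x) = 0 := by
  have hx : component k ℕ (fun n => M.summand n) 0 (M.incl (n + 1) x) = 0 := by
    rw [component.of, dif_neg n.succ_ne_zero]
  exact (congrArg (C.counitTensor M.carrier) hx).trans (map_zero _)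

theorem cobarContraction_incl_zero (x : M.summand 0) : cobarContraction M (M.incl 0 x) = 0 := by
  rw [cobarContraction, toModule_lof]
  rfl

theorem cobarContraction_incl_succ (n : ℕ) (x : M.summand (n + 1)) :
    cobarContraction M (M.incl (n + 1) x) = M.incl n (counitStep M n x) := by
  rw [cobarContraction, toModule_lof]
  rfl

theorem cobarRetraction_comp_d :
    cobarRetraction M ∘ₗ M.cobarComplex.d = M.d ∘ₗ cobarRetraction M :=
  LinearMap.ext fun x => (congrArg (C.counitTensor M.carrier) (component_zero_totalD x)).trans
    (LinearMap.congr_fun (DGCoalgebra.counitTensor_comp_tensorD M.toDGModule) _)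

theorem cobarRetraction_comp_cobarUnit :
    cobarRetraction M ∘ₗ DGPrecomodule.Hom.lin M.cobarUnit = LinearMap.id :=
  LinearMap.ext fun x => (cobarRetraction_incl_zero M _).trans
    (LinearMap.congr_fun M.counit_coact x)

theorem d_comp_cobarContraction_add :
    M.cobarComplex.d ∘ₗ cobarContraction M + cobarContraction M ∘ₗ M.cobarComplex.d =
      LinearMap.id - DGPrecomodule.Hom.lin M.cobarUnit ∘ₗ cobarRetraction M := by
  refine DirectSum.linearMap_ext _ fun n => LinearMap.ext fun x => ?_
  change M.cobarComplex.d (cobarContraction M (M.incl n x)) +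
    cobarContraction M (M.cobarComplex.d (M.incl n x)) =
      M.incl n x - M.incl 0 (M.coactZero (cobarRetraction M (M.incl n x)))
  rw [M.cobarComplex_d_incl, map_add, map_smul, cobarContraction_incl_succ]
  cases n with
  | zero =>
    rw [cobarContraction_incl_zero, cobarContraction_incl_zero, cobarRetraction_incl_zero,
      counitStep_bPrime_zero, map_sub, map_zero, smul_zero, zero_add, zero_add]
  | succ n =>
    have hneg (y : ⨁ n, M.summand n) : (-1 : k) ^ (n + 1) • y = -((-1 : k) ^ n • y) := by
      rw [pow_succ, mul_neg_one]
      exact neg_smul _ y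
    rw [cobarContraction_incl_succ, cobarContraction_incl_succ, cobarRetraction_incl_succ,
      M.cobarComplex_d_incl, counitStep_d, counitStep_bPrime_succ, map_sub, map_zero, map_zero,
      sub_zero, hneg]
    abel

theorem quasiIso_cobarUnit : QuasiIso M.cobarUnit :=
  quasiIso_of_contraction (cobarRetraction_comp_d M) (cobarRetraction_comp_cobarUnit M)
    (d_comp_cobarContraction_add M)

end Contraction

theorem isEquivalence_closedToDPlus (h : ∀ N : DGComodule.{u, v} C, N.LeftBounded →
    ∃ X : DGComodule.{u, v} C, X.LeftBounded ∧ IsClosedObj X ∧ ∃ f : N ⟶ X, QuasiIso f) :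
    (closedToDPlus C).IsEquivalence where
  faithful := ⟨fun {X Y} f g hfg =>
    ObjectProperty.hom_ext _ ((Y.2.2 X.1.as).1 (congrArg (fun t => t.hom) hfg))⟩
  full := ⟨fun {X Y} φ => by
    obtain ⟨f, hf⟩ := (Y.2.2 X.1.as).2 φ.hom
    exact ⟨ObjectProperty.homMk f, ObjectProperty.hom_ext _ hf⟩⟩
  essSurj := ⟨by
    rintro ⟨Y, N, hN, ⟨e⟩⟩
    obtain ⟨X, hXb, hXc, f, hf⟩ := h N hN
    have hq : quasiIsos C ((toH C).map f) := ⟨f, rfl, hf⟩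
    exact ⟨⟨(toH C).obj X, ⟨X, hXb, ⟨Iso.refl _⟩⟩, hXc⟩, ⟨(dPlus C).isoMk
      ((Localization.isoOfHom (toD C) (quasiIsos C) _ hq).symm ≪≫ e.symm)⟩⟩⟩

end DGCo

end

theorem mainTheorem6 {k : Type u} [Field k] (C : DGCo.DGCoalgebra.{u, v} k)
    (hC : C.PositivelyGraded) :
    (∀ M : DGCo.DGComodule.{u, v} C, M.LeftBounded →
      DGCo.IsClosedObj ((DGCo.cobarFunctor C).obj M) ∧
      ((DGCo.cobarFunctor C).obj M).LeftBounded ∧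
      DGCo.QuasiIso ((DGCo.cobarNat C).app M)) ∧
    (DGCo.closedToDPlus C).IsEquivalence := by
  have hres (M : DGCo.DGComodule.{u, v} C) (hM : M.LeftBounded) :
      DGCo.IsClosedObj M.cobar ∧ M.cobar.LeftBounded ∧ DGCo.QuasiIso M.cobarUnit :=
    ⟨(DGCo.isKInjective_cobar hC hM).isClosedObj, DGCo.leftBounded_cobar hC hM,
      DGCo.quasiIso_cobarUnit M⟩
  refine ⟨hres, DGCo.isEquivalence_closedToDPlus fun N hN => ?_⟩
  obtain ⟨hclosed, hbounded, hqis⟩ := hres N hN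
  exact ⟨N.cobar, hbounded, hclosed, N.cobarUnit, hqis⟩
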